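/- Let $\tilde{\mathcal A}$ be the $b$-adic completion $\{\sum_{\nu\ge 0} b^\nu P_\nu(a) : P_\nu\in\mathbb C[X]\}$ of the unital $\mathbb C$-algebra generated by $a,b$ with the relation $ab-ba=b^2$; it contains $\mathbb C[[b]]$. For $\lambda\in\mathbb C$ put $\mathcal E_\lambda:=\tilde{\mathcal A}/\tilde{\mathcal A}(a-\lambda b)$. An (a,b)-module is a left $\tilde{\mathcal A}$-module $F$ that is free of finite rank over $\mathbb C[[b]]$. Its saturation is $F^\sharp:=\sum_{j\ge 0}(b^{-1}a)^jF\subset F[b^{-1}]$, and $F$ is regular if $F^\sharp$ is finitely generated over $\mathbb C[[b]]$. The Bernstein polynomial of a regular $F$ is the minimal polynomial of the endomorphism induced by $-b^{-1}a$ on the finite-dimensional complex vector space $F^\sharp/bF^\sharp$. $F$ is geometric if it is regular and all roots of its Bernstein polynomial are negative rational numbers. A fresco is a geometric (a,b)-module generated by one element over $\tilde{\mathcal A}$. It is semi-simple if it admits an injective $\tilde{\mathcal A}$-linear map into a finite direct sum $\bigoplus_{i}\mathcal E_{\lambda_i}$ with $\lambda_i\in\mathbb C$. **Proposition.** Let $\mathcal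 F$ be a semi-simple fresco and let $\lambda\in\mathbb C$. Then $-\lambda$ is a root of the Bernstein polynomial of $\mathcal F$ if and only if there exists a surjective $\tilde{\mathcal A}$-linear map $\pi:\mathcal F\to\mathcal E_\lambda=\tilde{\mathcal A}/\tilde{\mathcal A}(a-\lambda b)$. -/

import Mathlib

open scoped Polynomial PowerSeries

noncomputable section

namespace Barlet

/-! ### The algebra `Ã`

`Ã` is the `b`-adic completion of the unital `ℂ`-algebra generated by `a` and `b` with the single
relation `a b - b a = b ^ 2`. Its elements are the formal series `∑ ν, b ^ ν * P ν (a)` with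
`P ν ∈ ℂ[X]` arbitrary. (As `b a = (a - b) b`, one gets the same algebra when the powers of `b` are
written on the right.) The series is stored as the power series over `ℂ[X]` with coefficients
`P ν`. -/

/-- The commutative space of symbols `∑ ν, P ν * b ^ ν`, `P ν ∈ ℂ[X]`; here `a` is the polynomial
variable and `b` the power series variable. -/
abbrev Symb : Type := PowerSeries (Polynomial ℂ)

/-- The derivation `∂ / ∂ a` on symbols (coefficientwise derivative). -/
def dA : Symb →ₗ[ℂ] Symb where
  toFun u := PowerSeries.mk fun n => Polynomial.derivative (PowerSeries.coeff n u)
  map_add' u v := by ext1 n; simp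
  map_smul' c u := by ext1 n; simp

/-- The derivation `b ^ 2 * ∂ / ∂ b` on symbols. It is the commutator of `a` with series in `b`. -/
def dB : Symb →ₗ[ℂ] Symb where
  toFun u := PowerSeries.X ^ 2 * PowerSeries.derivative (Polynomial ℂ) u
  map_add' u v := by simp [mul_add]
  map_smul' c u := by
    have h : PowerSeries.derivative ℂ[X] (c • u) = c • PowerSeries.derivative ℂ[X] u := by
      ext1 n
      simp [PowerSeries.coeff_derivative]
    rw [h, mul_smul_comm, RingHom.id_apply]

/-- The `j`-th term `(1 / j!) * (∂ / ∂ a) ^ j u * (b ^ 2 * ∂ / ∂ b) ^ j v` of the product. -/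
def starTerm (j : ℕ) (u v : Symb) : Symb :=
  ((j.factorial : ℂ)⁻¹) • ((dA ^ j) u * (dB ^ j) v)

/-- The normally ordered product of symbols,
`∑ j, (1 / j!) * (∂ / ∂ a) ^ j u * (b ^ 2 * ∂ / ∂ b) ^ j v`. Since the `j`-th term is divisible
by `b ^ j`, the coefficient of `b ^ n` only involves the terms with `j ≤ n`. -/
def starMul (u v : Symb) : Symb :=
  PowerSeries.mk fun n => ∑ j ∈ Finset.range (n + 1), PowerSeries.coeff n (starTerm j u v)

lemma dA_mul (u v : Symb) : dA (u * v) = dA u * v + u * dA v := by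
  ext1 n
  simp only [dA, LinearMap.coe_mk, AddHom.coe_mk, PowerSeries.coeff_mk, PowerSeries.coeff_mul,
    map_add, Polynomial.derivative_sum, Polynomial.derivative_mul, Finset.sum_add_distrib]

lemma dB_mul (u v : Symb) : dB (u * v) = dB u * v + u * dB v := by
  simp only [dB, LinearMap.coe_mk, AddHom.coe_mk, Derivation.leibniz, smul_eq_mul]
  ring

lemma dA_dB (u : Symb) : dA (dB u) = dB (dA u) := by
  ext1 n
  simp only [dA, dB, LinearMap.coe_mk, AddHom.coe_mk, PowerSeries.coeff_mk,
    PowerSeries.coeff_X_pow_mul']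
  split_ifs with h
  · have e : ∀ k : ℕ, (k + 1 : ℂ[X]) = Polynomial.C (k + 1 : ℂ) := fun k => by simp
    simp only [PowerSeries.coeff_derivative, e, PowerSeries.coeff_mk, Polynomial.derivative_mul,
      Polynomial.derivative_C, mul_zero, add_zero]
  · simp

lemma dAB_comm : Commute dA dB := LinearMap.ext dA_dB

lemma leibniz_pow (D : Symb →ₗ[ℂ] Symb) (hD : ∀ u v, D (u * v) = D u * v + u * D v) (n : ℕ)
    (u v : Symb) : ((n.factorial : ℂ)⁻¹) • (D ^ n) (u * v) =
      ∑ p ∈ Finset.HasAntidiagonal.antidiagonal n, (((p.1.factorial : ℂ)⁻¹) • (D ^ p.1) u) *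
        (((p.2.factorial : ℂ)⁻¹) • (D ^ p.2) v) := by
  have key : (D ^ n) (u * v) = ∑ p ∈ Finset.HasAntidiagonal.antidiagonal n,
      n.choose p.1 • ((D ^ p.1) u * (D ^ p.2) v) := by
    induction n with
    | zero => simp
    | succ n ih =>
      rw [Finset.sum_antidiagonal_choose_succ_nsmul
        (M := Symb) (fun i j => (D ^ i) u * (D ^ j) v) n, pow_succ', Module.End.mul_apply, ih,
        map_sum, ← Finset.sum_add_distrib]
      refine Finset.sum_congr rfl fun p hp => ?_
      rw [map_nsmul, hD, pow_succ', pow_succ', Module.End.mul_apply, Module.End.mul_apply,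
        Nat.choose_symm_of_eq_add (Finset.HasAntidiagonal.mem_antidiagonal.1 hp).symm, nsmul_add, add_comm]
  rw [key, Finset.smul_sum]
  refine Finset.sum_congr rfl fun p hp => ?_
  have h : p.1 + p.2 = n := Finset.HasAntidiagonal.mem_antidiagonal.1 hp
  rw [smul_mul_smul_comm, ← Nat.cast_smul_eq_nsmul ℂ, smul_smul]
  congr 1
  subst h
  have := Nat.add_choose_mul_factorial_mul_factorial p.1 p.2
  rw [← Nat.choose_symm_add] at this
  have h1 : (p.1.factorial : ℂ) ≠ 0 := by exact_mod_cast p.1.factorial_ne_zero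
  have h2 : (p.2.factorial : ℂ) ≠ 0 := by exact_mod_cast p.2.factorial_ne_zero
  have h3 : ((p.1 + p.2).factorial : ℂ) ≠ 0 := by exact_mod_cast (p.1 + p.2).factorial_ne_zero
  have h4 : ((p.1 + p.2).choose p.1 : ℂ) * p.1.factorial * p.2.factorial
    = (p.1 + p.2).factorial := by exact_mod_cast this
  field_simp
  linear_combination h4

lemma X_pow_dvd_dA {n : ℕ} {u : Symb} (h : PowerSeries.X ^ n ∣ u) :
    PowerSeries.X ^ n ∣ dA u := by
  rw [PowerSeries.X_pow_dvd_iff] at h ⊢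
  intro m hm
  simp [dA, h m hm]

lemma X_pow_dvd_dA_pow {n : ℕ} {u : Symb} (h : PowerSeries.X ^ n ∣ u) (j : ℕ) :
    PowerSeries.X ^ n ∣ (dA ^ j) u := by
  induction j with
  | zero => simpa using h
  | succ j ih => rw [pow_succ', Module.End.mul_apply]; exact X_pow_dvd_dA ih

lemma X_pow_dvd_dB {n : ℕ} {u : Symb} (h : PowerSeries.X ^ n ∣ u) :
    PowerSeries.X ^ (n + 1) ∣ dB u := by
  rw [PowerSeries.X_pow_dvd_iff] at h ⊢
  intro m hm
  simp only [dB, LinearMap.coe_mk, AddHom.coe_mk, PowerSeries.coeff_X_pow_mul']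
  split_ifs with h2
  · rw [PowerSeries.coeff_derivative, h _ (by omega), zero_mul]
  · rfl

lemma X_pow_dvd_dB_pow {n : ℕ} {u : Symb} (h : PowerSeries.X ^ n ∣ u) (j : ℕ) :
    PowerSeries.X ^ (n + j) ∣ (dB ^ j) u := by
  induction j with
  | zero => simpa using h
  | succ j ih => rw [pow_succ', Module.End.mul_apply, ← add_assoc]; exact X_pow_dvd_dB ih

lemma dvd_csmul {x u : Symb} (c : ℂ) (h : x ∣ u) : x ∣ c • u := by
  obtain ⟨w, rfl⟩ := h
  exact ⟨c • w, (mul_smul_comm c x w).symm⟩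

lemma X_pow_dvd_starTerm (j : ℕ) (u v : Symb) : PowerSeries.X ^ j ∣ starTerm j u v := by
  have h : PowerSeries.X ^ (0 + j) ∣ (dB ^ j) v := X_pow_dvd_dB_pow (by simp) j
  rw [zero_add] at h
  exact dvd_csmul _ (h.mul_left _)

lemma starTerm_dvd_left {N : ℕ} {u : Symb} (h : PowerSeries.X ^ N ∣ u) (j : ℕ) (v : Symb) :
    PowerSeries.X ^ N ∣ starTerm j u v :=
  dvd_csmul _ ((X_pow_dvd_dA_pow h j).mul_right _)

lemma starTerm_dvd_right {N : ℕ} {v : Symb} (h : PowerSeries.X ^ N ∣ v) (j : ℕ) (u : Symb) :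
    PowerSeries.X ^ N ∣ starTerm j u v :=
  dvd_csmul _ ((dvd_trans (pow_dvd_pow _ (Nat.le_add_right N j)) (X_pow_dvd_dB_pow h j)).mul_left _)

lemma starTerm_add_left (j : ℕ) (u u' v : Symb) :
    starTerm j (u + u') v = starTerm j u v + starTerm j u' v := by
  simp [starTerm, add_mul]

lemma starTerm_add_right (j : ℕ) (u v v' : Symb) :
    starTerm j u (v + v') = starTerm j u v + starTerm j u v' := by
  simp [starTerm, mul_add]

/-- Modulo `b ^ N`, the product only involves the terms with `j < N`. -/
lemma star_sub_dvd (N : ℕ) (u v : Symb) :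
    PowerSeries.X ^ N ∣ starMul u v - ∑ j ∈ Finset.range N, starTerm j u v := by
  rw [PowerSeries.X_pow_dvd_iff]
  intro m hm
  rw [map_sub, map_sum, starMul, PowerSeries.coeff_mk, sub_eq_zero]
  refine Finset.sum_subset (by simpa using hm) fun j _ hj => ?_
  exact PowerSeries.X_pow_dvd_iff.1 (X_pow_dvd_starTerm j u v) m (by simpa using hj)

lemma coeff_star {n N : ℕ} (h : n < N) (u v : Symb) : PowerSeries.coeff n (starMul u v) =
    ∑ j ∈ Finset.range N, PowerSeries.coeff n (starTerm j u v) := by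
  have := PowerSeries.X_pow_dvd_iff.1 (star_sub_dvd N u v) n h
  rwa [map_sub, map_sum, sub_eq_zero] at this

lemma sum_range_antidiagonal {M : Type*} [AddCommMonoid M] (N : ℕ) (f : ℕ → ℕ → M)
    (hf : ∀ i l, N ≤ i + l → f i l = 0) :
    ∑ k ∈ Finset.range N, ∑ p ∈ Finset.HasAntidiagonal.antidiagonal k, f p.1 p.2 =
      ∑ i ∈ Finset.range N, ∑ l ∈ Finset.range N, f i l := by
  rw [← Finset.sum_product', Finset.sum_sigma']
  refine Finset.sum_bij_ne_zero (fun (x : (_ : ℕ) × (ℕ × ℕ)) _ _ => x.2) ?_ ?_ ?_ ?_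
  · rintro ⟨k, i, l⟩ h _
    simp only [Finset.mem_sigma, Finset.mem_range, Finset.HasAntidiagonal.mem_antidiagonal, Finset.mem_product]
      at h ⊢
    omega
  · rintro ⟨k, i, l⟩ h _ ⟨k', i', l'⟩ h' _ e
    simp only [Finset.mem_sigma, Finset.mem_range, Finset.HasAntidiagonal.mem_antidiagonal, Prod.mk.injEq]
      at h h' e
    obtain ⟨rfl, rfl⟩ := e
    have : k = k' := by omega
    subst this
    rfl
  · rintro ⟨i, l⟩ h hne
    refine ⟨⟨i + l, i, l⟩, ?_, hne, rfl⟩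
    simp only [Finset.mem_sigma, Finset.mem_range, Finset.HasAntidiagonal.mem_antidiagonal, and_true]
    by_contra hc
    exact hne (hf i l (by omega))
  · intros; rfl

/-- The common form of the terms of a triple product. -/
def tripleTerm (i j l : ℕ) (u v w : Symb) : Symb :=
  ((i.factorial : ℂ)⁻¹ * (j.factorial : ℂ)⁻¹ * (l.factorial : ℂ)⁻¹) •
    ((dA ^ (i + j)) u * (dA ^ l) ((dB ^ j) v) * (dB ^ (i + l)) w)

lemma X_pow_dvd_tripleTerm (i j l : ℕ) (u v w : Symb) :
    PowerSeries.X ^ (i + j + l) ∣ tripleTerm i j l u v w := by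
  have h1 : PowerSeries.X ^ (0 + j) ∣ (dB ^ j) v := X_pow_dvd_dB_pow (by simp) j
  have h2 : PowerSeries.X ^ (0 + (i + l)) ∣ (dB ^ (i + l)) w := X_pow_dvd_dB_pow (by simp) _
  have h := mul_dvd_mul ((X_pow_dvd_dA_pow h1 l).mul_left ((dA ^ (i + j)) u)) h2
  rw [← pow_add] at h
  have e : i + j + l = 0 + j + (0 + (i + l)) := by omega
  rw [e]
  exact dvd_csmul _ h

lemma starTerm_starTerm_left (j k : ℕ) (u v w : Symb) :
    starTerm k (starTerm j u v) w =
      ∑ p ∈ Finset.HasAntidiagonal.antidiagonal k, tripleTerm p.1 j p.2 u v w := by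
  have h := leibniz_pow dA dA_mul k ((dA ^ j) u) ((dB ^ j) v)
  rw [starTerm, starTerm, map_smul, smul_mul_assoc, smul_comm, ← smul_mul_assoc, h,
    Finset.sum_mul, Finset.smul_sum]
  refine Finset.sum_congr rfl fun p hp => ?_
  have hk : p.1 + p.2 = k := Finset.HasAntidiagonal.mem_antidiagonal.1 hp
  subst hk
  rw [tripleTerm, smul_mul_smul_comm, smul_mul_assoc, smul_smul, pow_add dA, Module.End.mul_apply]
  congr 1
  ring

lemma csmul_triple_right (c d e : ℂ) (x y z : Symb) :
    c • (x * ((d • y) * (e • z))) = (c * d * e) • (x * y * z) := by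
  simp only [mul_smul_comm, smul_mul_assoc, smul_smul, mul_assoc]
  rw [mul_comm e d]

lemma starTerm_starTerm_right (m l : ℕ) (u v w : Symb) :
    starTerm m u (starTerm l v w) =
      ∑ p ∈ Finset.HasAntidiagonal.antidiagonal m, tripleTerm p.1 p.2 l u v w := by
  have h := leibniz_pow dB dB_mul m ((dA ^ l) v) ((dB ^ l) w)
  have e : starTerm m u (starTerm l v w) = ((l.factorial : ℂ)⁻¹) • ((dA ^ m) u *
      (((m.factorial : ℂ)⁻¹) • (dB ^ m) ((dA ^ l) v * (dB ^ l) w))) := by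
    simp only [starTerm, map_smul, mul_smul_comm]
    rw [smul_comm]
  rw [e, h, Finset.mul_sum, Finset.smul_sum, ← Finset.Nat.sum_antidiagonal_swap]
  refine Finset.sum_congr rfl fun p hp => ?_
  have hk : p.1 + p.2 = m := Finset.HasAntidiagonal.mem_antidiagonal.1 hp
  subst hk
  have hc : (dB ^ p.2) ((dA ^ l) v) = (dA ^ l) ((dB ^ p.2) v) := by
    have := (dAB_comm.pow_pow l p.2).eq
    exact (LinearMap.congr_fun this v).symm
  simp only [Prod.fst_swap, Prod.snd_swap]
  rw [tripleTerm, hc, pow_add dB, Module.End.mul_apply, csmul_triple_right]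
  congr 1
  ring

lemma star_add_left (u u' v : Symb) : starMul (u + u') v = starMul u v + starMul u' v := by
  ext1 n
  simp [starMul, starTerm_add_left, Finset.sum_add_distrib]

lemma star_add_right (u v v' : Symb) : starMul u (v + v') = starMul u v + starMul u v' := by
  ext1 n
  simp [starMul, starTerm_add_right, Finset.sum_add_distrib]

lemma star_zero_left (u : Symb) : starMul 0 u = 0 := by
  simpa using star_add_left 0 0 u

lemma star_zero_right (u : Symb) : starMul u 0 = 0 := by
  simpa using star_add_right u 0 0

lemma coeff_star_star_left (n : ℕ) (u v w : Symb) : PowerSeries.coeff n (starMul (starMul u v) w) =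
    ∑ i ∈ Finset.range (n + 1), ∑ j ∈ Finset.range (n + 1), ∑ l ∈ Finset.range (n + 1),
      PowerSeries.coeff n (tripleTerm i j l u v w) := by
  have hz : ∀ i j l, n + 1 ≤ i + j + l →
      PowerSeries.coeff n (tripleTerm i j l u v w) = 0 := fun i j l h =>
    PowerSeries.X_pow_dvd_iff.1 (X_pow_dvd_tripleTerm i j l u v w) n (by omega)
  have h1 : ∀ k, PowerSeries.coeff n (starTerm k (starMul u v) w) =
      ∑ j ∈ Finset.range (n + 1), ∑ p ∈ Finset.HasAntidiagonal.antidiagonal k,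
        PowerSeries.coeff n (tripleTerm p.1 j p.2 u v w) := by
    intro k
    have e : starTerm k (starMul u v) w = starTerm k (starMul u v -
        ∑ j ∈ Finset.range (n + 1), starTerm j u v) w +
        ∑ j ∈ Finset.range (n + 1), starTerm k (starTerm j u v) w := by
      conv_lhs => rw [← sub_add_cancel (starMul u v)
        (∑ j ∈ Finset.range (n + 1), starTerm j u v), starTerm_add_left]
      congr 1
      simp [starTerm, Finset.sum_mul, Finset.smul_sum]
    rw [e, map_add, PowerSeries.X_pow_dvd_iff.1
      (starTerm_dvd_left (star_sub_dvd (n + 1) u v) k w) n (by omega), zero_add, map_sum]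
    simp [starTerm_starTerm_left]
  rw [coeff_star (Nat.lt_succ_self n), Finset.sum_congr rfl fun k _ => h1 k, Finset.sum_comm,
    Finset.sum_comm (s := Finset.range (n + 1)) (t := Finset.range (n + 1))]
  conv_rhs => rw [Finset.sum_comm]
  rw [Finset.sum_comm]
  exact Finset.sum_congr rfl fun j _ => sum_range_antidiagonal (n + 1)
    (fun i l => PowerSeries.coeff n (tripleTerm i j l u v w)) fun i l h => hz i j l (by omega)

lemma coeff_star_star_right (n : ℕ) (u v w : Symb) : PowerSeries.coeff n (starMul u (starMul v w)) =
    ∑ i ∈ Finset.range (n + 1), ∑ j ∈ Finset.range (n + 1), ∑ l ∈ Finset.range (n + 1),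
      PowerSeries.coeff n (tripleTerm i j l u v w) := by
  have hz : ∀ i j l, n + 1 ≤ i + j + l →
      PowerSeries.coeff n (tripleTerm i j l u v w) = 0 := fun i j l h =>
    PowerSeries.X_pow_dvd_iff.1 (X_pow_dvd_tripleTerm i j l u v w) n (by omega)
  have h1 : ∀ m, PowerSeries.coeff n (starTerm m u (starMul v w)) =
      ∑ l ∈ Finset.range (n + 1), ∑ p ∈ Finset.HasAntidiagonal.antidiagonal m,
        PowerSeries.coeff n (tripleTerm p.1 p.2 l u v w) := by
    intro m
    have e : starTerm m u (starMul v w) = starTerm m u (starMul v w -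
        ∑ l ∈ Finset.range (n + 1), starTerm l v w) +
        ∑ l ∈ Finset.range (n + 1), starTerm m u (starTerm l v w) := by
      conv_lhs => rw [← sub_add_cancel (starMul v w)
        (∑ l ∈ Finset.range (n + 1), starTerm l v w), starTerm_add_right]
      congr 1
      simp [starTerm, Finset.mul_sum, Finset.smul_sum]
    rw [e, map_add, PowerSeries.X_pow_dvd_iff.1
      (starTerm_dvd_right (star_sub_dvd (n + 1) v w) m u) n (by omega), zero_add, map_sum]
    simp [starTerm_starTerm_right]
  rw [coeff_star (Nat.lt_succ_self n), Finset.sum_congr rfl fun k _ => h1 k, Finset.sum_comm]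
  have h2 : ∀ l ∈ Finset.range (n + 1), ∑ k ∈ Finset.range (n + 1),
      ∑ p ∈ Finset.HasAntidiagonal.antidiagonal k, PowerSeries.coeff n (tripleTerm p.1 p.2 l u v w) =
      ∑ i ∈ Finset.range (n + 1), ∑ j ∈ Finset.range (n + 1),
        PowerSeries.coeff n (tripleTerm i j l u v w) := fun l _ =>
    sum_range_antidiagonal (n + 1)
      (fun i j => PowerSeries.coeff n (tripleTerm i j l u v w)) fun i j h => hz i j l (by omega)
  rw [Finset.sum_congr rfl h2, Finset.sum_comm]
  exact Finset.sum_congr rfl fun i _ => Finset.sum_comm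

lemma star_assoc (u v w : Symb) : starMul (starMul u v) w = starMul u (starMul v w) := by
  ext1 n
  rw [coeff_star_star_left, coeff_star_star_right]

/-- A product with a left factor free of `a` is the ordinary product. -/
lemma star_of_dA_eq_zero {u : Symb} (h : dA u = 0) (v : Symb) : starMul u v = u * v := by
  ext1 n
  rw [starMul, PowerSeries.coeff_mk, Finset.sum_eq_single 0]
  · simp [starTerm]
  · intro j _ hj
    obtain ⟨j, rfl⟩ := Nat.exists_eq_succ_of_ne_zero hj
    simp [starTerm, pow_succ, h]
  · simp

/-- A product with a right factor free of `b` is the ordinary product. -/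
lemma star_of_dB_eq_zero {v : Symb} (h : dB v = 0) (u : Symb) : starMul u v = u * v := by
  ext1 n
  rw [starMul, PowerSeries.coeff_mk, Finset.sum_eq_single 0]
  · simp [starTerm]
  · intro j _ hj
    obtain ⟨j, rfl⟩ := Nat.exists_eq_succ_of_ne_zero hj
    simp [starTerm, pow_succ, h]
  · simp

lemma dA_map_C (f : ℂ⟦X⟧) : dA (PowerSeries.map Polynomial.C f) = 0 := by
  ext1 n
  simp [dA]

lemma dB_C (P : ℂ[X]) : dB (PowerSeries.C P) = 0 := by
  simp [dB]

/-- The algebra `Ã` of formal series `∑ ν, b ^ ν * P ν (a)`; see the head of this section. -/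
def ATilde : Type := Symb

namespace ATilde

instance : AddCommGroup ATilde := inferInstanceAs (AddCommGroup Symb)

/-- The element `∑ ν, b ^ ν * P ν (a)` whose `P ν` are the coefficients of `u`. -/
def ofSymb (u : Symb) : ATilde := u

instance : Ring ATilde where
  __ := (inferInstance : AddCommGroup ATilde)
  mul u v := ofSymb (starMul u v)
  one := ofSymb 1
  mul_assoc u v w := star_assoc u v w
  one_mul u := (star_of_dA_eq_zero (u := 1) (by simpa using dA_map_C 1) u).trans
    (one_mul (M := Symb) u)
  mul_one u := (star_of_dB_eq_zero (v := 1) (by simpa using dB_C 1) u).trans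
    (mul_one (M := Symb) u)
  left_distrib u v w := star_add_right u v w
  right_distrib u v w := star_add_left u v w
  zero_mul u := star_zero_left u
  mul_zero u := star_zero_right u

lemma ofSymb_mul (u v : Symb) : ofSymb u * ofSymb v = ofSymb (starMul u v) := rfl

/-- The generator `a`. -/
def a : ATilde := ofSymb (PowerSeries.C Polynomial.X)

/-- The inclusion `ℂ⟦b⟧ ⊆ Ã` of the formal power series in `b`. -/
def ofSeries : ℂ⟦X⟧ →+* ATilde where
  toFun f := ofSymb (PowerSeries.map Polynomial.C f)
  map_zero' := map_zero (PowerSeries.map (Polynomial.C (R := ℂ)))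
  map_one' := map_one (PowerSeries.map (Polynomial.C (R := ℂ)))
  map_add' := map_add (PowerSeries.map (Polynomial.C (R := ℂ)))
  map_mul' f g := (map_mul (PowerSeries.map (Polynomial.C (R := ℂ))) f g).trans
    (star_of_dA_eq_zero (dA_map_C f) _).symm

/-- The generator `b`. -/
def b : ATilde := ofSeries PowerSeries.X

/-- `a f(b) = f(b) a + b ^ 2 f'(b)`. -/
lemma a_mul_ofSeries (f : ℂ⟦X⟧) : a * ofSeries f =
    ofSeries f * a + ofSeries (PowerSeries.X ^ 2 * PowerSeries.derivative ℂ f) := by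
  have hd : PowerSeries.map Polynomial.C (PowerSeries.derivative ℂ f) =
      PowerSeries.derivative ℂ[X] (PowerSeries.map Polynomial.C f) := by
    ext1 n
    simp [PowerSeries.coeff_derivative]
  have hA : dA (PowerSeries.C Polynomial.X) = 1 := by
    ext1 n
    simp only [dA, LinearMap.coe_mk, AddHom.coe_mk, PowerSeries.coeff_mk, PowerSeries.coeff_C,
      PowerSeries.coeff_one]
    split_ifs <;> simp
  have hA1 : dA (1 : Symb) = 0 := by simpa using dA_map_C 1
  have key : starMul (PowerSeries.C Polynomial.X) (PowerSeries.map Polynomial.C f) =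
      PowerSeries.map Polynomial.C f * PowerSeries.C Polynomial.X +
      PowerSeries.map Polynomial.C (PowerSeries.X ^ 2 * PowerSeries.derivative ℂ f) := by
    ext1 n
    have h2 : ∀ j, 2 ≤ j →
        starTerm j (PowerSeries.C Polynomial.X) (PowerSeries.map Polynomial.C f) = 0 := by
      intro j hj
      obtain ⟨k, rfl⟩ := Nat.exists_eq_add_of_le' hj
      simp [starTerm, pow_succ, hA, hA1]
    rw [coeff_star (show n < n + 2 by omega), Finset.sum_range_succ', Finset.sum_range_succ',
      Finset.sum_eq_zero fun j _ => by rw [h2 _ (by omega), map_zero]]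
    have hB : dB (PowerSeries.map Polynomial.C f) =
        PowerSeries.map Polynomial.C (PowerSeries.X ^ 2 * PowerSeries.derivative ℂ f) := by
      rw [map_mul, hd, map_pow, PowerSeries.map_X]
      rfl
    rw [← hB, zero_add, zero_add, ← map_add]
    congr 1
    simp only [starTerm, pow_one, pow_zero, hA, Module.End.one_apply, one_mul,
      Nat.factorial_zero, Nat.factorial_one, Nat.cast_one, inv_one, one_smul]
    rw [add_comm, mul_comm (PowerSeries.C _)]
  have h3 : starMul (PowerSeries.map Polynomial.C f) (PowerSeries.C Polynomial.X) =
      PowerSeries.map Polynomial.C f * PowerSeries.C Polynomial.X :=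
    star_of_dA_eq_zero (dA_map_C f) _
  rw [← h3] at key
  exact key

/-- The defining relation of the algebra. -/
lemma a_mul_b_sub : a * b - b * a = b ^ 2 := by
  rw [b, a_mul_ofSeries, add_sub_cancel_left, ← map_pow]
  simp

/-- `Ã` as a left module over `ℂ⟦b⟧`. -/
instance : Module ℂ⟦X⟧ ATilde := Module.compHom ATilde ofSeries

lemma series_smul_def (f : ℂ⟦X⟧) (u : ATilde) : f • u = ofSeries f * u := rfl

instance : IsScalarTower ℂ⟦X⟧ ATilde ATilde where
  smul_assoc f u v := mul_assoc (ofSeries f) u v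

instance : Module ℂ ATilde := Module.compHom ATilde (algebraMap ℂ ℂ⟦X⟧)

instance : IsScalarTower ℂ ATilde ATilde where
  smul_assoc c u v := mul_assoc (ofSeries (algebraMap ℂ ℂ⟦X⟧ c)) u v

instance : IsScalarTower ℂ ℂ⟦X⟧ ATilde where
  smul_assoc c f u := by
    rw [Algebra.smul_def, mul_smul]
    rfl

end ATilde

open ATilde

/-- The module `E_λ = Ã / Ã (a - λ b)` (quotient by a left ideal). -/
abbrev E (lam : ℂ) : Type :=
  ATilde ⧸ (Submodule.span ATilde {a - ofSeries (PowerSeries.C lam) * b})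

/-! ### (a,b)-modules, saturation and Bernstein polynomial

Below, `F` is a left `Ã`-module; its structures of `ℂ⟦b⟧`-module and of `ℂ`-vector space are the
ones given by `ℂ ⊆ ℂ⟦b⟧ ⊆ Ã` (this is what the scalar tower conditions say). -/

section Modules

variable (F : Type*) [AddCommGroup F] [Module ℂ⟦X⟧ F] [Module ATilde F]
  [IsScalarTower ℂ⟦X⟧ ATilde F]

/-- The localization `F[b⁻¹]`. -/
abbrev Loc : Type _ := LocalizedModule (Submonoid.powers (PowerSeries.X : ℂ⟦X⟧)) F

variable {F}

lemma ofSeries_smul (f : ℂ⟦X⟧) (x : F) : ofSeries f • x = f • x := by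
  rw [← one_smul ATilde x, ← smul_assoc f (1 : ATilde) x, series_smul_def, mul_one, one_smul]

lemma a_smul_series_smul (f : ℂ⟦X⟧) (x : F) : a • (f • x) =
    f • (a • x) + (PowerSeries.X ^ 2 * PowerSeries.derivative ℂ f) • x := by
  rw [← ofSeries_smul f x, smul_smul, a_mul_ofSeries, add_smul, mul_smul, ofSeries_smul,
    ofSeries_smul]

/-- `b * f ^ 2` as an element of the powers of `b`, when `f` is one. -/
def den (f : Submonoid.powers (PowerSeries.X : ℂ⟦X⟧)) :
    Submonoid.powers (PowerSeries.X : ℂ⟦X⟧) :=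
  ⟨PowerSeries.X, Submonoid.mem_powers _⟩ * f ^ 2

/-- `b⁻¹ a (f⁻¹ x) = (f a x - b ^ 2 f' x) / (b f ^ 2)`, for `f` a power of `b`: this is the only
possible value, as `a f = f a + b ^ 2 f'` on `F[b⁻¹]`. -/
def nablaMk (p : F × Submonoid.powers (PowerSeries.X : ℂ⟦X⟧)) : Loc F :=
  LocalizedModule.mk ((p.2 : ℂ⟦X⟧) • (a • p.1) -
    (PowerSeries.X ^ 2 * PowerSeries.derivative ℂ (p.2 : ℂ⟦X⟧)) • p.1) (den p.2)

lemma nabla_wd_aux {R M : Type*} [CommRing R] [AddCommGroup M] [Module R M]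
    (t c f g c' f' g' : R) (x y x' y' : M) :
    (c ^ 2 * (t * g ^ 2 * f)) • x' - (c ^ 2 * (t * g ^ 2 * (t ^ 2 * f'))) • x -
      ((c ^ 2 * (t * f ^ 2 * g)) • y' - (c ^ 2 * (t * f ^ 2 * (t ^ 2 * g'))) • y) =
    (t * (c * f * g * (c * g))) • x' + (t * (c * f * g * (t ^ 2 * (c * g' + g * c')))) • x -
      (t * (t ^ 2 * (c * g * f' + f * g * c' + c * f * g') * (c * g))) • x -
    ((t * (c * f * g * (c * f))) • y' + (t * (c * f * g * (t ^ 2 * (c * f' + f * c')))) • y -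
      (t * (t ^ 2 * (c * g * f' + f * g * c' + c * f * g') * (c * f))) • y) := by
  module

lemma nablaMk_wd (p q : F × Submonoid.powers (PowerSeries.X : ℂ⟦X⟧)) (h : p ≈ q) :
    nablaMk p = nablaMk q := by
  obtain ⟨x, f, hf⟩ := p
  obtain ⟨y, g, hg⟩ := q
  obtain ⟨⟨c, hc⟩, h⟩ := h
  simp only [Submonoid.smul_def, smul_smul] at h
  refine LocalizedModule.mk_eq.2 ⟨⟨c, hc⟩ ^ 2, ?_⟩
  have h2 := congrArg (fun z => (c * f * g) • (a • z)) h
  simp only [a_smul_series_smul, Derivation.leibniz, smul_eq_mul, smul_add, smul_smul] at h2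
  have h3 := congrArg (fun z => (PowerSeries.X ^ 2 * (c * g * PowerSeries.derivative ℂ f +
    f * g * PowerSeries.derivative ℂ c + c * f * PowerSeries.derivative ℂ g)) • z) h
  simp only [smul_smul] at h3
  simp only [den, Submonoid.smul_def, Submonoid.coe_mul, SubmonoidClass.coe_pow, smul_sub,
    smul_smul]
  have h4 := congrArg (fun z => (PowerSeries.X : ℂ⟦X⟧) • z) (congrArg₂ (· - ·) h2 h3)
  simp only [smul_sub, smul_add, smul_smul] at h4
  generalize a • x = x' at *
  generalize a • y = y' at *
  rw [← sub_eq_zero] at h4 ⊢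
  exact (nabla_wd_aux _ _ _ _ _ _ _ _ _ _ _).trans h4

/-- The operator `b⁻¹ a` on `F[b⁻¹]`, as a map. -/
def nablaFun (z : Loc F) : Loc F := LocalizedModule.liftOn z nablaMk nablaMk_wd

lemma nablaFun_mk (x : F) (f : Submonoid.powers (PowerSeries.X : ℂ⟦X⟧)) :
    nablaFun (LocalizedModule.mk x f) = nablaMk (x, f) :=
  LocalizedModule.liftOn_mk _ _ _

lemma nabla_add_aux {R M : Type*} [CommRing R] [AddCommGroup M] [Module R M]
    (t f g f' g' : R) (x y x' y' : M) :
    (t * f ^ 2 * (t * g ^ 2)) • ((f * g) • ((g • x' + (t ^ 2 * g') • x) +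
      (f • y' + (t ^ 2 * f') • y)) - (t ^ 2 * (f * g' + g * f')) • (g • x + f • y)) =
    (t * (f * g) ^ 2) • ((t * g ^ 2) • (f • x' - (t ^ 2 * f') • x) +
      (t * f ^ 2) • (g • y' - (t ^ 2 * g') • y)) := by
  module

lemma nablaFun_add (z w : Loc F) : nablaFun (z + w) = nablaFun z + nablaFun w := by
  induction z using LocalizedModule.induction_on with | _ x f
  induction w using LocalizedModule.induction_on with | _ y g
  rw [LocalizedModule.mk_add_mk, nablaFun_mk, nablaFun_mk, nablaFun_mk, nablaMk, nablaMk, nablaMk,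
    LocalizedModule.mk_add_mk, LocalizedModule.mk_eq]
  refine ⟨1, ?_⟩
  simp only [one_smul, den, Submonoid.smul_def, Submonoid.coe_mul, SubmonoidClass.coe_pow,
    smul_add, a_smul_series_smul, Derivation.leibniz, smul_eq_mul]
  simpa only [smul_add] using nabla_add_aux PowerSeries.X (f : ℂ⟦X⟧) g
    (PowerSeries.derivative ℂ (f : ℂ⟦X⟧)) (PowerSeries.derivative ℂ (g : ℂ⟦X⟧)) x y (a • x) (a • y)

lemma nabla_smul_aux {R M : Type*} [CommRing R] [AddCommGroup M] [Module R M]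
    (t f h f' h' : R) (x x' : M) :
    (t * f ^ 2 * f) • (f • (h • x' + (t ^ 2 * h') • x) - (t ^ 2 * f') • (h • x)) =
    (t * f ^ 2) • (f • (h • (f • x' - (t ^ 2 * f') • x)) + (t * f ^ 2) • ((t * h') • x)) := by
  module

/-- `b⁻¹ a h = h b⁻¹ a + b h'` for `h ∈ ℂ⟦b⟧`. -/
lemma nablaFun_smul (h : ℂ⟦X⟧) (z : Loc F) : nablaFun (h • z) =
    h • nablaFun z + (PowerSeries.X * PowerSeries.derivative ℂ h) • z := by
  induction z using LocalizedModule.induction_on with | _ x f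
  rw [LocalizedModule.smul'_mk, LocalizedModule.smul'_mk, nablaFun_mk, nablaFun_mk, nablaMk,
    nablaMk, LocalizedModule.smul'_mk, LocalizedModule.mk_add_mk, LocalizedModule.mk_eq]
  refine ⟨1, ?_⟩
  simp only [one_smul, den, Submonoid.smul_def, Submonoid.coe_mul, SubmonoidClass.coe_pow,
    a_smul_series_smul]
  exact nabla_smul_aux PowerSeries.X (f : ℂ⟦X⟧) h (PowerSeries.derivative ℂ (f : ℂ⟦X⟧))
    (PowerSeries.derivative ℂ h) x (a • x)

variable (F)

/-- An (a,b)-module: an `Ã`-module that is free of finite rank over `ℂ⟦b⟧`. -/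
structure IsABModule : Prop where
  free : Module.Free ℂ⟦X⟧ F
  finite : Module.Finite ℂ⟦X⟧ F

/-- The saturation `F^♯ = ∑ j, (b⁻¹ a) ^ j F ⊆ F[b⁻¹]`. -/
def sharp : Submodule ℂ⟦X⟧ (Loc F) :=
  Submodule.span ℂ⟦X⟧ {z | ∃ (j : ℕ) (x : F), z = nablaFun^[j] (LocalizedModule.mk x 1)}

variable {F} in
lemma nablaFun_mem_sharp {z : Loc F} (hz : z ∈ sharp F) : nablaFun z ∈ sharp F := by
  induction hz using Submodule.span_induction with
  | mem z hz =>
    obtain ⟨j, x, rfl⟩ := hz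
    exact Submodule.subset_span ⟨j + 1, x, (Function.iterate_succ_apply' _ _ _).symm⟩
  | zero =>
    have h := nablaFun_add (0 : Loc F) 0
    rw [add_zero, left_eq_add] at h
    rw [h]
    exact (sharp F).zero_mem
  | add z w _ _ hz hw =>
    rw [nablaFun_add]
    exact (sharp F).add_mem hz hw
  | smul h z hz' hz =>
    rw [nablaFun_smul]
    exact (sharp F).add_mem ((sharp F).smul_mem _ hz) ((sharp F).smul_mem _ hz')

/-- A regular (a,b)-module: the saturation is finitely generated over `ℂ⟦b⟧`. -/
structure IsRegular : Prop extends IsABModule F where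
  sharp_fg : (sharp F).FG

variable [Module ℂ F] [IsScalarTower ℂ ℂ⟦X⟧ F]

/-- The operator `b⁻¹ a` on `F^♯`. -/
def nablaSharp : sharp F →ₗ[ℂ] sharp F where
  toFun z := ⟨nablaFun z.1, nablaFun_mem_sharp z.2⟩
  map_add' z w := Subtype.ext (nablaFun_add z.1 w.1)
  map_smul' c z := Subtype.ext <| by
    have h := nablaFun_smul (algebraMap ℂ ℂ⟦X⟧ c) z.1
    rw [Derivation.map_algebraMap, mul_zero, zero_smul, add_zero, algebraMap_smul,
      algebraMap_smul] at h
    exact h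

/-- The `ℂ`-subspace `b F^♯` of `F^♯`. -/
def bSharp : Submodule ℂ (sharp F) :=
  (LinearMap.range (LinearMap.lsmul ℂ⟦X⟧ (sharp F) PowerSeries.X)).restrictScalars ℂ

lemma bSharp_le : bSharp F ≤ (bSharp F).comap (-nablaSharp F) := by
  rintro _ ⟨z, rfl⟩
  refine ⟨-(nablaSharp F z + z), Subtype.ext ?_⟩
  have h := nablaFun_smul PowerSeries.X z.1
  rw [PowerSeries.derivative_X, mul_one, ← smul_add] at h
  have e := congrArg (fun w => -w) h.symm
  simpa [nablaSharp] using e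

/-- The endomorphism of the `ℂ`-vector space `F^♯ / b F^♯` induced by `-b⁻¹ a`. -/
def residue : (sharp F ⧸ bSharp F) →ₗ[ℂ] (sharp F ⧸ bSharp F) :=
  Submodule.mapQ (bSharp F) (bSharp F) (-nablaSharp F) (bSharp_le F)

/-- The Bernstein polynomial of a regular (a,b)-module: the minimal polynomial of `-b⁻¹ a` on
`F^♯ / b F^♯`. -/
def bernsteinPoly : ℂ[X] := minpoly ℂ (residue F)

/-- A geometric (a,b)-module: it is regular and the roots of its Bernstein polynomial are negative
rational numbers. -/
structure IsGeometric : Prop extends IsRegular F where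
  roots_neg_rat : ∀ z : ℂ, (bernsteinPoly F).IsRoot z → ∃ q : ℚ, q < 0 ∧ z = q

/-- A fresco: a geometric (a,b)-module generated over `Ã` by one element. -/
structure IsFresco : Prop extends IsGeometric F where
  monogenic : ∃ e : F, Submodule.span ATilde {e} = ⊤

end Modules

/-- An (a,b)-module is semi-simple when it embeds in a finite direct sum of modules `E_λ`. -/
def IsSemisimple (F : Type*) [AddCommGroup F] [Module ATilde F] : Prop :=
  ∃ (n : ℕ) (lam : Fin n → ℂ) (j : F →ₗ[ATilde] (∀ i, E (lam i))), Function.Injective j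

end Barlet

end

open scoped Polynomial PowerSeries

noncomputable section

namespace Barlet

/-! In the coordinate given by its generator, `E_λ` is `ℂ⟦b⟧` with `b⁻¹ a` acting as `λ + b d/db`,
so `b ^ m` is an eigenvector of weight `λ + m`. A surjection `F → E_λ` is therefore a surjective
`ℂ⟦b⟧`-linear `Ψ : F → ℂ⟦b⟧` intertwining these actions (`exists_surjective_E_iff`). On the other
side, `-λ` is a root of the Bernstein polynomial iff the transpose of the residue has an
eigenvector: a nonzero functional `φ` on `F^♯`, zero on `b F^♯`, with `φ ∘ b⁻¹ a = λ φ`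
(`isRoot_bernsteinPoly_iff`). It remains to pass between `Ψ` and `φ`.

From `Ψ` to `φ`: `Ψ` extends to `F^♯` with values in `ℂ⟦b⟧`, as `ℂ⟦b⟧` is stable under `λ + b d/db`;
its constant term is `φ` (`exists_functional_of_surjective`).

From `φ` to `Ψ`: semi-simplicity embeds `F^♯` in some `ℂ⟦b⟧ ^ n` on which `b⁻¹ a` is diagonal on
monomials. A polynomial in `b⁻¹ a` kills the unwanted weights up to high order, and Artin-Rees puts
what is left in `b F^♯`; so `φ` depends only on the component of weight `λ`
(`eq_zero_of_component_eq_zero`), through a linear form `ψ` on `ℂ ^ n`. Applying the same `ψ` to the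
components of weights `λ + k` gives the coefficients of a morphism with constant term `φ`
(`exists_lift`). It takes a unit value on `F`, since `F` generates `F^♯` under `b⁻¹ a` and `φ ≠ 0`.

Throughout, `F^♯` is handled through an injection `L : F^♯ → F`, multiplication by a common
denominator `b ^ k`, which shifts all weights by `k`. -/

/-! ### `ℂ⟦b⟧`-modules separated for the `b`-adic topology -/

/-- The `b`-adic topology of the `ℂ⟦b⟧`-module `M` is separated. -/
def IsXSeparated (M : Type*) [AddCommGroup M] [Module ℂ⟦X⟧ M] : Prop :=
  ∀ x : M, (∀ N : ℕ, ∃ y : M, x = (PowerSeries.X ^ N : ℂ⟦X⟧) • y) → x = 0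

lemma isXSeparated_series : IsXSeparated ℂ⟦X⟧ := by
  intro f hf
  ext1 n
  obtain ⟨g, rfl⟩ := hf (n + 1)
  rw [smul_eq_mul, PowerSeries.coeff_X_pow_mul', if_neg (by omega), map_zero]

lemma IsXSeparated.of_equiv {M N : Type*} [AddCommGroup M] [Module ℂ⟦X⟧ M] [AddCommGroup N]
    [Module ℂ⟦X⟧ N] (h : IsXSeparated M) (e : M ≃ₗ[ℂ⟦X⟧] N) : IsXSeparated N := by
  intro x hx
  refine (LinearEquiv.map_eq_zero_iff e.symm).1 (h _ fun n => ?_)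
  obtain ⟨y, hy⟩ := hx n
  exact ⟨e.symm y, by rw [hy, map_smul]⟩

/-- If each value of `δ` is `b` times another value, then `δ` vanishes. -/
lemma IsXSeparated.eq_zero_of_step {M A : Type*} [AddCommGroup M] [Module ℂ⟦X⟧ M]
    (h : IsXSeparated M) (δ : A → M)
    (hδ : ∀ u, ∃ v, δ u = (PowerSeries.X : ℂ⟦X⟧) • δ v) (u : A) : δ u = 0 := by
  refine h _ fun N => ?_
  suffices ∀ u, ∃ v, δ u = (PowerSeries.X ^ N : ℂ⟦X⟧) • δ v by
    obtain ⟨v, hv⟩ := this u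
    exact ⟨_, hv⟩
  induction N with
  | zero => exact fun u => ⟨u, by simp⟩
  | succ N ih =>
    intro u
    obtain ⟨v, hv⟩ := ih u
    obtain ⟨w, hw⟩ := hδ v
    exact ⟨w, by rw [hv, hw, smul_smul, pow_succ]⟩

/-- The series without its constant term, divided by the variable. -/
def shift {R : Type*} [Semiring R] (f : PowerSeries R) : PowerSeries R :=
  PowerSeries.mk fun n => PowerSeries.coeff (n + 1) f

lemma C_add_X_mul_shift {R : Type*} [CommRing R] (f : PowerSeries R) :
    f = PowerSeries.C (PowerSeries.coeff 0 f) + PowerSeries.X * shift f := by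
  ext1 n
  cases n with
  | zero => simp
  | succ n => simp [shift, PowerSeries.coeff_succ_X_mul]

lemma C_smul {M : Type*} [AddCommGroup M] [Module ℂ⟦X⟧ M] [Module ℂ M] [IsScalarTower ℂ ℂ⟦X⟧ M]
    (c : ℂ) (x : M) : (PowerSeries.C c : ℂ⟦X⟧) • x = c • x :=
  algebraMap_smul ℂ⟦X⟧ c x

/-- A `ℂ`-linear map commuting with `b` is `ℂ⟦b⟧`-linear. -/
lemma map_series_smul {M N : Type*} [AddCommGroup M] [Module ℂ⟦X⟧ M] [Module ℂ M]
    [IsScalarTower ℂ ℂ⟦X⟧ M] [AddCommGroup N] [Module ℂ⟦X⟧ N] [Module ℂ N]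
    [IsScalarTower ℂ ℂ⟦X⟧ N] (hN : IsXSeparated N) (g : M →ₗ[ℂ] N)
    (hg : ∀ x, g ((PowerSeries.X : ℂ⟦X⟧) • x) = (PowerSeries.X : ℂ⟦X⟧) • g x) (f : ℂ⟦X⟧) (x : M) :
    g (f • x) = f • g x := by
  -- Constants pass through `g`, so the defect at `f` is `b` times the defect at `shift f`.
  refine sub_eq_zero.1 (hN.eq_zero_of_step (fun f : ℂ⟦X⟧ => g (f • x) - f • g x)
    (fun f => ⟨shift f, ?_⟩) f)
  have e := C_add_X_mul_shift f
  conv_lhs => rw [e]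
  rw [add_smul, add_smul, map_add, C_smul, C_smul, map_smul, mul_smul, mul_smul, hg, smul_sub]
  abel

/-! ### Coefficients in `Ã`, and division by `b` and by `a - λ b`. -/

namespace ATilde

/-- The series `∑ ν, b ^ ν * P ν (a)` as a power series with coefficients `P ν`. -/
def toSymb (u : ATilde) : Symb := u

lemma a_mul_ofSymb_C (P : ℂ[X]) :
    a * ofSymb (PowerSeries.C P) = ofSymb (PowerSeries.C (Polynomial.X * P)) := by
  rw [a, ofSymb_mul, star_of_dB_eq_zero (dB_C _), ← map_mul]

lemma ofSeries_mul_ofSymb (f : ℂ⟦X⟧) (u : Symb) :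
    ofSeries f * ofSymb u = ofSymb (PowerSeries.map Polynomial.C f * u) :=
  congrArg ofSymb (star_of_dA_eq_zero (dA_map_C f) u)

lemma b_mul_ofSymb (u : Symb) : b * ofSymb u = ofSymb (PowerSeries.X * u) := by
  rw [b, ofSeries_mul_ofSymb, PowerSeries.map_X]

lemma ofSeries_C (c : ℂ) : ofSeries (PowerSeries.C c) = ofSymb (PowerSeries.C (Polynomial.C c)) :=
  congrArg ofSymb (PowerSeries.map_C (Polynomial.C (R := ℂ)) c)

/-- The coefficient of `b ^ n` in `∑ ν, b ^ ν * P ν (a)`. -/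
def cf (n : ℕ) (u : ATilde) : ℂ[X] := PowerSeries.coeff n (toSymb u)

lemma cf_add (n : ℕ) (u v : ATilde) : cf n (u + v) = cf n u + cf n v :=
  map_add (PowerSeries.coeff n) (toSymb u) v

lemma cf_sub (n : ℕ) (u v : ATilde) : cf n (u - v) = cf n u - cf n v :=
  map_sub (PowerSeries.coeff n) (toSymb u) v

lemma ext_cf {u v : ATilde} (h : ∀ n, cf n u = cf n v) : u = v :=
  PowerSeries.ext (φ := (toSymb u)) h

/-- Modulo `b` the algebra becomes the commutative ring `ℂ[a]`: only the term `j = 0` of the product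
has a part free of `b`. -/
lemma cf_zero_mul (u v : ATilde) : cf 0 (u * v) = cf 0 u * cf 0 v := by
  change PowerSeries.coeff 0 (starMul (toSymb u) (toSymb v)) = _
  simp [starMul, starTerm, cf]

lemma cf_ofSeries (n : ℕ) (f : ℂ⟦X⟧) :
    cf n (ofSeries f) = Polynomial.C (PowerSeries.coeff n f) :=
  PowerSeries.coeff_map (Polynomial.C (R := ℂ)) n f

lemma cf_mk (n : ℕ) (g : ℕ → ℂ[X]) : cf n (ofSymb (PowerSeries.mk g)) = g n :=
  PowerSeries.coeff_mk n g

lemma cf_zero_a : cf 0 a = Polynomial.X := PowerSeries.coeff_zero_C _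

lemma cf_succ_b_mul (n : ℕ) (u : ATilde) : cf (n + 1) (b * u) = cf n u := by
  have h : toSymb (b * u) = PowerSeries.X * toSymb u := b_mul_ofSymb (toSymb u)
  rw [cf, h, PowerSeries.coeff_succ_X_mul, cf]

lemma cf_zero_b_mul (u : ATilde) : cf 0 (b * u) = 0 := by
  rw [cf_zero_mul, b, cf_ofSeries]
  simp

lemma b_mul_cancel {u v : ATilde} (h : b * u = b * v) : u = v :=
  ext_cf fun n => by rw [← cf_succ_b_mul, h, cf_succ_b_mul]

/-- Division by `b`, for elements without constant term. -/
def tail (u : ATilde) : ATilde := ofSymb (shift (toSymb u))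

lemma cf_tail (n : ℕ) (u : ATilde) : cf n (tail u) = cf (n + 1) u := cf_mk n _

lemma eq_ofSymb_C_add (u : ATilde) : u = ofSymb (PowerSeries.C (cf 0 u)) + b * tail u := by
  rw [tail, b_mul_ofSymb]
  exact C_add_X_mul_shift (toSymb u)

lemma b_mul_tail {u : ATilde} (h : cf 0 u = 0) : b * tail u = u := by
  conv_rhs => rw [eq_ofSymb_C_add u, h, map_zero]
  exact (zero_add _).symm

lemma eq_zero_of_step {A : Type*} (δ : A → ATilde) (hδ : ∀ u, ∃ v, δ u = b * δ v) (u : A) :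
    δ u = 0 := by
  refine ext_cf fun n => ?_
  change cf n (δ u) = PowerSeries.coeff n (0 : Symb)
  rw [map_zero]
  induction n generalizing u with
  | zero =>
    obtain ⟨v, hv⟩ := hδ u
    rw [hv, cf_zero_b_mul]
  | succ n ih =>
    obtain ⟨v, hv⟩ := hδ u
    rw [hv, cf_succ_b_mul, ih]

/-- A `ℂ⟦b⟧`-linear map on `Ã` that vanishes at `1` and is compatible with some operator `T` as the
action of `a` vanishes. -/
lemma addHom_eq_zero {M : Type*} [AddCommGroup M] [Module ℂ⟦X⟧ M] (hM : IsXSeparated M)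
    (δ : ATilde →+ M) (hs : ∀ f u, δ (ofSeries f * u) = f • δ u) (h1 : δ 1 = 0)
    (T : M → M) (hT : T 0 = 0) (ha : ∀ u, δ (a * u) = T (δ u)) (u : ATilde) : δ u = 0 := by
  -- Vanishing on `ℂ[a]` goes by induction on the degree, using `T 0 = 0`; then `u = P(a) + b * tail
  -- u` gives `δ u = b • δ (tail u)`, and separatedness concludes.
  have hC : ∀ P : ℂ[X], δ (ofSymb (PowerSeries.C P)) = 0 := by
    have hadd : ∀ P Q : ℂ[X], ofSymb (PowerSeries.C (P + Q)) =
        ofSymb (PowerSeries.C P) + ofSymb (PowerSeries.C Q) := fun P Q =>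
      map_add (PowerSeries.C (R := ℂ[X])) P Q
    intro P
    induction P using Polynomial.induction_on with
    | C c => rw [← ofSeries_C, ← mul_one (ofSeries _), hs, h1, smul_zero]
    | add P Q hP hQ => rw [hadd, map_add, hP, hQ, add_zero]
    | monomial n c h =>
      rw [pow_succ', mul_left_comm, ← a_mul_ofSymb_C, ha, h, hT]
  refine hM.eq_zero_of_step δ (fun u => ⟨tail u, ?_⟩) u
  conv_lhs => rw [eq_ofSymb_C_add u]
  rw [map_add, hC, zero_add, b, hs]

/-! ### The modules `E_λ` -/

/-- Modulo `b` the divisor is `a`, so this is the division of the polynomial `cf 0 u` by `X`; the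
error is a multiple of `b`. -/
lemma exists_division_step (lam : ℂ) (u : ATilde) : ∃ (p : ℂ) (q : ℂ[X]) (v : ATilde),
    u = ofSeries (PowerSeries.C p) +
      ofSymb (PowerSeries.C q) * (a - ofSeries (PowerSeries.C lam) * b) + b * v := by
  refine ⟨(cf 0 u).coeff 0, (cf 0 u).divX, tail (u - (ofSeries (PowerSeries.C ((cf 0 u).coeff 0)) +
      ofSymb (PowerSeries.C (cf 0 u).divX) * (a - ofSeries (PowerSeries.C lam) * b))), ?_⟩
  rw [b_mul_tail, add_sub_cancel]
  rw [cf_sub, cf_add, cf_zero_mul, cf_sub, cf_zero_mul, b, cf_ofSeries, cf_ofSeries, cf_ofSeries,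
    cf_zero_a]
  have h : cf 0 (ofSymb (PowerSeries.C (cf 0 u).divX)) = (cf 0 u).divX :=
    PowerSeries.coeff_zero_C _
  rw [h]
  simp only [PowerSeries.coeff_zero_C, PowerSeries.coeff_zero_X, map_zero, mul_zero, sub_zero]
  rw [add_comm, Polynomial.divX_mul_X_add, sub_self]

/-- Division by `a - λ b` on the right, with remainder in `ℂ⟦b⟧`. -/
lemma exists_division (lam : ℂ) (u : ATilde) : ∃ (f : ℂ⟦X⟧) (v : ATilde),
    u = ofSeries f + v * (a - ofSeries (PowerSeries.C lam) * b) := by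
  choose p q r h using exists_division_step lam
  -- The error `r u` is divided again, and so on: the `n`-th remainder and quotient contribute the
  -- coefficients of `b ^ n`. The total defect at `u` is then `b` times the defect at `r u`, hence
  -- zero.
  let f : ATilde → ℂ⟦X⟧ := fun u => PowerSeries.mk fun n => p (r^[n] u)
  let v : ATilde → ATilde := fun u => ofSymb (PowerSeries.mk fun n => q (r^[n] u))
  refine ⟨f u, v u, ?_⟩
  have hf : ∀ u, ofSeries (f u) = ofSeries (PowerSeries.C (p u)) + b * ofSeries (f (r u)) := by
    intro u
    rw [b, ← map_mul, ← map_add]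
    congr 1
    conv_lhs => rw [C_add_X_mul_shift (f u)]
    simp [f, shift]
  have hv : ∀ u, v u = ofSymb (PowerSeries.C (q u)) + b * v (r u) := by
    intro u
    have e : tail (v u) = v (r u) := by
      refine ext_cf fun n => ?_
      rw [cf_tail, cf_mk, cf_mk, Function.iterate_succ_apply]
    rw [← e]
    conv_lhs => rw [eq_ofSymb_C_add (v u)]
    congr 3
    exact cf_mk 0 _
  refine sub_eq_zero.1 (eq_zero_of_step (fun u : ATilde =>
    u - (ofSeries (f u) + v u * (a - ofSeries (PowerSeries.C lam) * b))) (fun u => ⟨r u, ?_⟩) u)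
  rw [hf, hv u]
  conv_lhs => enter [1]; rw [h u]
  noncomm_ring

/-- Infinite descent: modulo `b` the equation reads `f(0) = P(a) a`, so `f` and `v` are both
divisible by `b`, and their quotients satisfy the same equation. -/
lemma eq_zero_of_ofSeries_eq_mul {lam : ℂ} {f : ℂ⟦X⟧} {v : ATilde}
    (h : ofSeries f = v * (a - ofSeries (PowerSeries.C lam) * b)) : f = 0 := by
  refine isXSeparated_series.eq_zero_of_step
    (fun p : {p : ℂ⟦X⟧ × ATilde // ofSeries p.1 =
      p.2 * (a - ofSeries (PowerSeries.C lam) * b)} => p.1.1) ?_ ⟨(f, v), h⟩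
  rintro ⟨⟨f, v⟩, h⟩
  simp only at h
  have h0 := congrArg (cf 0) h
  rw [cf_zero_mul, cf_sub, cf_zero_mul, b, cf_ofSeries, cf_ofSeries, cf_ofSeries, cf_zero_a] at h0
  simp only [PowerSeries.coeff_zero_X, map_zero, mul_zero, sub_zero] at h0
  have hf0 : PowerSeries.coeff 0 f = 0 := by
    simpa using congrArg (fun P => Polynomial.coeff P 0) h0
  have hv0 : cf 0 v = 0 := by
    rw [hf0, map_zero] at h0
    exact (mul_eq_zero.1 h0.symm).resolve_right Polynomial.X_ne_zero
  have hf : f = PowerSeries.X * shift f := by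
    conv_lhs => rw [C_add_X_mul_shift f, hf0, map_zero, zero_add]
  refine ⟨⟨(shift f, tail v), b_mul_cancel ?_⟩, hf⟩
  rw [← mul_assoc, b_mul_tail hv0, ← h]
  conv_rhs => rw [hf]
  rw [b, map_mul]

end ATilde

open ATilde

/-- The generator of `E_λ`. -/
def E.gen (lam : ℂ) : E lam := Submodule.Quotient.mk 1

lemma E.mk_ofSeries (lam : ℂ) (f : ℂ⟦X⟧) :
    (Submodule.Quotient.mk (ofSeries f) : E lam) = f • E.gen lam := by
  rw [E.gen, ← Submodule.Quotient.mk_smul, series_smul_def, mul_one]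

lemma E.a_smul_gen (lam : ℂ) :
    a • E.gen lam = (PowerSeries.C lam * PowerSeries.X : ℂ⟦X⟧) • E.gen lam := by
  rw [← E.mk_ofSeries, E.gen, ← Submodule.Quotient.mk_smul, smul_eq_mul, mul_one,
    Submodule.Quotient.eq, map_mul]
  exact Submodule.mem_span_singleton_self _

/-- Uniqueness and existence of the remainder in the division by `a - λ b`. -/
lemma E.gen_bijective (lam : ℂ) :
    Function.Bijective (LinearMap.toSpanSingleton ℂ⟦X⟧ (E lam) (E.gen lam)) := by
  constructor
  · refine (injective_iff_map_eq_zero _).2 fun f hf => ?_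
    rw [LinearMap.toSpanSingleton_apply, ← E.mk_ofSeries, Submodule.Quotient.mk_eq_zero,
      Submodule.mem_span_singleton] at hf
    obtain ⟨v, hv⟩ := hf
    exact eq_zero_of_ofSeries_eq_mul hv.symm
  · intro x
    obtain ⟨u, rfl⟩ := Submodule.Quotient.mk_surjective _ x
    obtain ⟨f, v, h⟩ := exists_division lam u
    refine ⟨f, ?_⟩
    rw [LinearMap.toSpanSingleton_apply, ← E.mk_ofSeries, eq_comm, Submodule.Quotient.eq,
      Submodule.mem_span_singleton]
    exact ⟨v, by rw [h, add_sub_cancel_left, smul_eq_mul]⟩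

/-- `E_λ` is free over `ℂ⟦b⟧` on its generator. -/
def E.equiv (lam : ℂ) : ℂ⟦X⟧ ≃ₗ[ℂ⟦X⟧] E lam := LinearEquiv.ofBijective _ (E.gen_bijective lam)

lemma E.equiv_apply (lam : ℂ) (f : ℂ⟦X⟧) : E.equiv lam f = f • E.gen lam := rfl

/-- The operator `b⁻¹ a` becomes `λ + b d/db`, diagonal on monomials; every later weight computation
rests on this. -/
lemma E.a_smul_equiv (lam : ℂ) (f : ℂ⟦X⟧) : a • E.equiv lam f =
    E.equiv lam (PowerSeries.X * (lam • f + PowerSeries.X * PowerSeries.derivative ℂ f)) := by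
  rw [E.equiv_apply, a_smul_series_smul, E.a_smul_gen, smul_smul, ← add_smul, E.equiv_apply,
    PowerSeries.smul_eq_C_mul]
  congr 1
  ring

lemma E.equiv_symm_a_smul (lam : ℂ) (x : E lam) : (E.equiv lam).symm (a • x) =
    PowerSeries.X * (lam • (E.equiv lam).symm x +
      PowerSeries.X * PowerSeries.derivative ℂ ((E.equiv lam).symm x)) := by
  conv_lhs => rw [← (E.equiv lam).apply_symm_apply x]
  rw [E.a_smul_equiv, LinearEquiv.symm_apply_apply]

/-! ### Morphisms to `E_λ` in coordinates. -/

section Hom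

variable {F : Type*} [AddCommGroup F] [Module ℂ⟦X⟧ F] [Module ATilde F]
  [IsScalarTower ℂ⟦X⟧ ATilde F]

lemma map_series_smul_of_ATilde {G : Type*} [AddCommGroup G] [Module ℂ⟦X⟧ G] [Module ATilde G]
    [IsScalarTower ℂ⟦X⟧ ATilde G] (π : F →ₗ[ATilde] G) (f : ℂ⟦X⟧) (x : F) :
    π (f • x) = f • π x := by
  rw [← ofSeries_smul, map_smul, ofSeries_smul]

/-- Surjections onto `E_λ`, in terms of the coordinate on `E_λ`. -/
lemma exists_surjective_E_iff (lam : ℂ) :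
    (∃ π : F →ₗ[ATilde] E lam, Function.Surjective π) ↔
      ∃ Ψ : F →ₗ[ℂ⟦X⟧] ℂ⟦X⟧, (∀ x, Ψ (a • x) =
        PowerSeries.X * (lam • Ψ x + PowerSeries.X * PowerSeries.derivative ℂ (Ψ x))) ∧
        Function.Surjective Ψ := by
  constructor
  · rintro ⟨π, hπ⟩
    refine ⟨(E.equiv lam).symm.toLinearMap ∘ₗ
      { π.toAddMonoidHom with map_smul' := map_series_smul_of_ATilde π }, fun x => ?_,
      (E.equiv lam).symm.surjective.comp hπ⟩
    exact (congrArg _ (map_smul π a x)).trans (E.equiv_symm_a_smul lam _)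
  · rintro ⟨Ψ, hΨ, hs⟩
    refine ⟨{ toFun := fun x => E.equiv lam (Ψ x), map_add' := fun x y => by simp,
              map_smul' := fun u x => ?_ }, (E.equiv lam).surjective.comp hs⟩
    -- For fixed `x`, the defect of linearity is `ℂ⟦b⟧`-linear in `u`, commutes with `a` and
    -- vanishes at `1`.
    refine sub_eq_zero.1 (addHom_eq_zero (isXSeparated_series.of_equiv (E.equiv lam))
      { toFun := fun u : ATilde => E.equiv lam (Ψ (u • x)) - u • E.equiv lam (Ψ x)
        map_zero' := by simp
        map_add' := fun u v => by simp only [add_smul, map_add]; abel } ?_ ?_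
      (fun y => a • y) (smul_zero a) ?_ u)
    · intro f u
      simp only [AddMonoidHom.coe_mk, ZeroHom.coe_mk, mul_smul, ofSeries_smul, map_smul, smul_sub]
    · simp
    · intro u
      simp only [AddMonoidHom.coe_mk, ZeroHom.coe_mk, mul_smul, smul_sub, E.a_smul_equiv, hΨ]

end Hom

/-! ### The saturation of a regular (a,b)-module -/

section Sharp

variable {F : Type*} [AddCommGroup F] [Module ℂ⟦X⟧ F]

lemma loc_X_pow_smul_injective (k : ℕ) :
    Function.Injective fun z : Loc F => (PowerSeries.X ^ k : ℂ⟦X⟧) • z :=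
  IsLocalizedModule.smul_injective
    (LocalizedModule.mkLinearMap (Submonoid.powers (PowerSeries.X : ℂ⟦X⟧)) F)
    ⟨PowerSeries.X ^ k, Submonoid.mem_powers_iff _ _ |>.2 ⟨k, rfl⟩⟩

lemma mkLinearMap_injective [Module.Free ℂ⟦X⟧ F] : Function.Injective
    (LocalizedModule.mkLinearMap (Submonoid.powers (PowerSeries.X : ℂ⟦X⟧)) F) := by
  intro x y h
  obtain ⟨⟨_, k, rfl⟩, hc⟩ := LocalizedModule.mk_eq.1 h
  simp only [one_smul, Submonoid.smul_def] at hc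
  exact smul_right_injective F (pow_ne_zero k PowerSeries.X_ne_zero) hc

/-- A finitely generated submodule of `F[b⁻¹]` has a common denominator. -/
lemma exists_common_den {P : Submodule ℂ⟦X⟧ (Loc F)} (hP : P.FG) : ∃ k : ℕ, ∀ z ∈ P, ∃ x : F,
    LocalizedModule.mk x 1 = (PowerSeries.X ^ k : ℂ⟦X⟧) • z := by
  induction P, hP using Submodule.fg_induction with
  | singleton z =>
    induction z using LocalizedModule.induction_on with | _ x f
    obtain ⟨f, k, rfl⟩ := f
    refine ⟨k, fun z hz => ?_⟩
    obtain ⟨g, rfl⟩ := Submodule.mem_span_singleton.1 hz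
    refine ⟨g • x, ?_⟩
    rw [smul_comm, LocalizedModule.smul'_mk, LocalizedModule.smul'_mk, LocalizedModule.mk_eq]
    refine ⟨1, ?_⟩
    simp [Submonoid.smul_def, smul_comm g]
  | sup P Q _ _ hP hQ =>
    obtain ⟨k, hk⟩ := hP
    obtain ⟨l, hl⟩ := hQ
    refine ⟨k + l, fun z hz => ?_⟩
    obtain ⟨u, hu, w, hw, rfl⟩ := Submodule.mem_sup.1 hz
    obtain ⟨x, hx⟩ := hk u hu
    obtain ⟨y, hy⟩ := hl w hw
    refine ⟨(PowerSeries.X ^ l : ℂ⟦X⟧) • x + (PowerSeries.X ^ k : ℂ⟦X⟧) • y, ?_⟩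
    have h := map_add (LocalizedModule.mkLinearMap (Submonoid.powers (PowerSeries.X : ℂ⟦X⟧)) F)
      ((PowerSeries.X ^ l : ℂ⟦X⟧) • x) ((PowerSeries.X ^ k : ℂ⟦X⟧) • y)
    rw [map_smul, map_smul] at h
    refine h.trans ?_
    rw [LocalizedModule.mkLinearMap_apply, LocalizedModule.mkLinearMap_apply, hx, hy, smul_smul,
      smul_smul, ← pow_add, ← pow_add, add_comm l k, smul_add]

variable [Module ATilde F] [IsScalarTower ℂ⟦X⟧ ATilde F]

lemma X_smul_nablaFun_mk (x : F) :
    (PowerSeries.X : ℂ⟦X⟧) • nablaFun (LocalizedModule.mk x 1) =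
      (LocalizedModule.mk (a • x) 1 : Loc F) := by
  rw [nablaFun_mk, nablaMk, LocalizedModule.smul'_mk, LocalizedModule.mk_eq]
  refine ⟨1, ?_⟩
  simp [den, Submonoid.smul_def]

/-- Clearing a common denominator `b ^ k` moves `F^♯` into the image of `F` in `F[b⁻¹]`, which
freeness identifies with `F`. -/
lemma exists_lattice_map [Module.Free ℂ⟦X⟧ F] (h : (sharp F).FG) :
    ∃ (k : ℕ) (L : sharp F →ₗ[ℂ⟦X⟧] F), ∀ z : sharp F,
      LocalizedModule.mk (L z) 1 = (PowerSeries.X ^ k : ℂ⟦X⟧) • (z : Loc F) := by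
  obtain ⟨k, hk⟩ := exists_common_den h
  let ι := LocalizedModule.mkLinearMap (Submonoid.powers (PowerSeries.X : ℂ⟦X⟧)) F
  let m : sharp F →ₗ[ℂ⟦X⟧] LinearMap.range ι :=
    LinearMap.codRestrict _ ((PowerSeries.X ^ k : ℂ⟦X⟧) • (sharp F).subtype) fun z => hk z z.2
  refine ⟨k, (LinearEquiv.ofInjective ι mkLinearMap_injective).symm.toLinearMap ∘ₗ m,
    fun z => ?_⟩
  exact congrArg Subtype.val
    ((LinearEquiv.ofInjective ι mkLinearMap_injective).apply_symm_apply (m z))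

lemma lattice_map_injective {k : ℕ} {L : sharp F →ₗ[ℂ⟦X⟧] F}
    (hL : ∀ z : sharp F,
      LocalizedModule.mk (L z) 1 = (PowerSeries.X ^ k : ℂ⟦X⟧) • (z : Loc F)) :
    Function.Injective L := by
  intro z w h
  exact Subtype.ext (loc_X_pow_smul_injective k (by simp only; rw [← hL, ← hL, h]))

/-- The element `x / 1` of the saturation. -/
def toSharp : F →ₗ[ℂ⟦X⟧] sharp F :=
  LinearMap.codRestrict _
    (LocalizedModule.mkLinearMap (Submonoid.powers (PowerSeries.X : ℂ⟦X⟧)) F)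
    fun x => Submodule.subset_span ⟨0, x, rfl⟩

variable [Module ℂ F] [IsScalarTower ℂ ℂ⟦X⟧ F]

lemma nablaSharp_smul (f : ℂ⟦X⟧) (z : sharp F) : nablaSharp F (f • z) =
    f • nablaSharp F z + (PowerSeries.X * PowerSeries.derivative ℂ f) • z :=
  Subtype.ext (nablaFun_smul f z.1)

lemma X_smul_nablaSharp_toSharp (x : F) :
    (PowerSeries.X : ℂ⟦X⟧) • nablaSharp F (toSharp x) = toSharp (a • x) :=
  Subtype.ext (X_smul_nablaFun_mk x)

/-- A submodule of the saturation which contains `F` and is stable under `b⁻¹ a` is everything. -/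
lemma mem_of_nablaSharp_stable (P : Submodule ℂ⟦X⟧ (sharp F)) (h0 : ∀ x, toSharp x ∈ P)
    (hP : ∀ z ∈ P, nablaSharp F z ∈ P) (z : sharp F) : z ∈ P := by
  obtain ⟨z, hz⟩ := z
  suffices h : sharp F ≤ P.map (sharp F).subtype by
    obtain ⟨w, hw, rfl⟩ := h hz
    exact hw
  refine Submodule.span_le.2 ?_
  rintro _ ⟨j, x, rfl⟩
  induction j with
  | zero => exact ⟨_, h0 x, rfl⟩
  | succ j ih =>
    obtain ⟨w, hw, e⟩ := ih
    exact ⟨_, hP w hw, by rw [Function.iterate_succ_apply', ← e]; rfl⟩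

/-- Since `L` is multiplication by `b ^ k`, this is the commutation rule `b⁻¹ a b ^ k = b ^ k (b⁻¹ a
+ k)`. -/
lemma a_smul_lattice_map [Module.Free ℂ⟦X⟧ F] {k : ℕ} {L : sharp F →ₗ[ℂ⟦X⟧] F}
    (hL : ∀ z : sharp F,
      LocalizedModule.mk (L z) 1 = (PowerSeries.X ^ k : ℂ⟦X⟧) • (z : Loc F)) (z : sharp F) :
    a • L z = (PowerSeries.X : ℂ⟦X⟧) • (L (nablaSharp F z) + (k : ℂ⟦X⟧) • L z) := by
  have hL' : ∀ z, toSharp (L z) = (PowerSeries.X ^ k : ℂ⟦X⟧) • z := fun z => Subtype.ext (hL z)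
  have hinj : Function.Injective (toSharp (F := F)) := fun x y h =>
    mkLinearMap_injective (congrArg Subtype.val h)
  apply hinj
  rw [← X_smul_nablaSharp_toSharp, hL', nablaSharp_smul, map_smul, map_add, map_smul, hL', hL']
  congr 2
  rw [smul_smul]
  congr 1
  -- The exponent `k - 1` in the derivative of `b ^ k` is truncated, so `k = 0` is separate.
  cases k with
  | zero => simp
  | succ k =>
    simp only [Derivation.leibniz_pow, PowerSeries.derivative_X, add_tsub_cancel_right, smul_eq_mul,
      nsmul_eq_mul, mul_one]
    ring

lemma mem_bSharp {z : sharp F} : z ∈ bSharp F ↔ ∃ w, (PowerSeries.X : ℂ⟦X⟧) • w = z := Iff.rfl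

/-- On `F^♯ / b F^♯` a series acts through its constant term, so generators over `ℂ⟦b⟧` span over
`ℂ`. -/
lemma finite_quotient (h : (sharp F).FG) : Module.Finite ℂ (sharp F ⧸ bSharp F) := by
  have hf : Module.Finite ℂ⟦X⟧ (sharp F) := Module.Finite.iff_fg.2 h
  obtain ⟨s, hs⟩ := hf.fg_top
  classical
  refine ⟨⟨s.image (bSharp F).mkQ, ?_⟩⟩
  rw [eq_top_iff]
  rintro x -
  obtain ⟨z, rfl⟩ := (bSharp F).mkQ_surjective x
  have hz : z ∈ Submodule.span ℂ⟦X⟧ (s : Set (sharp F)) := hs ▸ Submodule.mem_top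
  induction hz using Submodule.span_induction with
  | mem z hz => exact Submodule.subset_span (Finset.mem_coe.2 (Finset.mem_image_of_mem _ hz))
  | zero => rw [map_zero]; exact Submodule.zero_mem _
  | add z w _ _ hz hw => rw [map_add]; exact Submodule.add_mem _ hz hw
  | smul f z _ hz =>
    have e : (bSharp F).mkQ (f • z) = PowerSeries.coeff 0 f • (bSharp F).mkQ z := by
      rw [← map_smul, ← C_smul (M := sharp F), ← sub_eq_zero, ← map_sub, Submodule.mkQ_apply,
        Submodule.Quotient.mk_eq_zero]
      refine mem_bSharp.2 ⟨shift f • z, ?_⟩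
      conv_rhs => enter [1]; rw [C_add_X_mul_shift f]
      rw [add_smul, add_sub_cancel_left, mul_smul]
    rw [e]
    exact Submodule.smul_mem _ _ hz

/-- The roots of the Bernstein polynomial, in terms of functionals on the saturation. -/
lemma isRoot_bernsteinPoly_iff (h : (sharp F).FG) (lam : ℂ) :
    (bernsteinPoly F).IsRoot (-lam) ↔ ∃ φ : sharp F →ₗ[ℂ] ℂ, φ ≠ 0 ∧
      (∀ z, φ ((PowerSeries.X : ℂ⟦X⟧) • z) = 0) ∧ ∀ z, φ (nablaSharp F z) = lam * φ z := by
  have hfin := finite_quotient h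
  constructor
  · intro hr
    have he : Module.End.HasEigenvalue (residue F) (-lam) :=
      Module.End.hasEigenvalue_of_isRoot hr
    -- In finite dimension an eigenvalue also prevents surjectivity; a nonzero functional vanishing
    -- on the range is an eigenvector of the transpose.
    have hlt : LinearMap.range (residue F - algebraMap ℂ (Module.End ℂ (sharp F ⧸ bSharp F)) (-lam)) < ⊤ := by
      rw [lt_top_iff_ne_top]
      intro ht
      have hi := LinearMap.injective_iff_surjective.2 (LinearMap.range_eq_top.1 ht)
      obtain ⟨v, hv⟩ := he.exists_hasEigenvector
      refine hv.2 (hi ?_)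
      rw [map_zero, LinearMap.sub_apply, hv.apply_eq_smul, Module.algebraMap_end_apply, sub_self]
    obtain ⟨ψ, hψ, hle⟩ := Submodule.exists_le_ker_of_lt_top _ hlt
    refine ⟨ψ ∘ₗ (bSharp F).mkQ, ?_, fun z => ?_, fun z => ?_⟩
    · intro h0
      refine hψ (LinearMap.ext fun x => ?_)
      obtain ⟨z, rfl⟩ := (bSharp F).mkQ_surjective x
      exact LinearMap.congr_fun h0 z
    · have : (bSharp F).mkQ ((PowerSeries.X : ℂ⟦X⟧) • z) = 0 :=
        (Submodule.Quotient.mk_eq_zero _).2 (mem_bSharp.2 ⟨z, rfl⟩)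
      rw [LinearMap.comp_apply, this, map_zero]
    · have h1 : ψ ((residue F - algebraMap ℂ (Module.End ℂ (sharp F ⧸ bSharp F)) (-lam)) ((bSharp F).mkQ z)) = 0 :=
        hle ⟨_, rfl⟩
      have h2 : residue F ((bSharp F).mkQ z) = -(bSharp F).mkQ (nablaSharp F z) := by
        rw [← map_neg]
        rfl
      rw [LinearMap.sub_apply, Module.algebraMap_end_apply, h2, map_sub, map_neg, map_smul,
        smul_eq_mul] at h1
      rw [LinearMap.comp_apply, LinearMap.comp_apply]
      linear_combination -h1
  · rintro ⟨φ, hφ, hX, hn⟩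
    let ψ : (sharp F ⧸ bSharp F) →ₗ[ℂ] ℂ := (bSharp F).liftQ φ (by
      intro z hz
      obtain ⟨w, rfl⟩ := mem_bSharp.1 hz
      exact hX w)
    have h1 : ∀ x, ψ (residue F x) = -lam * ψ x := by
      intro x
      obtain ⟨z, rfl⟩ := (bSharp F).mkQ_surjective x
      have : ψ (residue F ((bSharp F).mkQ z)) = φ (-nablaSharp F z) := rfl
      rw [this, map_neg, hn, neg_mul]
      rfl
    -- Applied to the minimal polynomial, this shows that its value at `-λ` annihilates `ψ`, which
    -- is nonzero.
    have h2 : ∀ (P : ℂ[X]) x, ψ (Polynomial.aeval (residue F) P x) = P.eval (-lam) * ψ x := by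
      intro P
      induction P using Polynomial.induction_on with
      | C c => intro x; simp
      | add P Q hP hQ =>
        intro x
        rw [map_add, LinearMap.add_apply, map_add, hP, hQ, Polynomial.eval_add, add_mul]
      | monomial n c hP =>
        intro x
        rw [pow_succ, ← mul_assoc, map_mul, Module.End.mul_apply, hP, Polynomial.aeval_X, h1,
          Polynomial.eval_mul_X, mul_assoc]
    by_contra hr
    refine hφ (LinearMap.ext fun z => ?_)
    have h3 := h2 (bernsteinPoly F) ((bSharp F).mkQ z)
    rw [bernsteinPoly, minpoly.aeval, LinearMap.zero_apply, map_zero] at h3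
    exact (mul_eq_zero.1 h3.symm).resolve_left hr

end Sharp

/-! ### Lifting eigenfunctionals -/

/-- The coefficient of `b ^ μ` of a power series, for a complex exponent `μ`. -/
def expCoeff (μ : ℂ) : ℂ⟦X⟧ →ₗ[ℂ] ℂ :=
  open Classical in if h : ∃ m : ℕ, (m : ℂ) = μ then PowerSeries.coeff h.choose else 0

lemma expCoeff_natCast (m : ℕ) : expCoeff m = PowerSeries.coeff m := by
  have h : ∃ k : ℕ, (k : ℂ) = (m : ℂ) := ⟨m, rfl⟩
  rw [expCoeff, dif_pos h, Nat.cast_injective h.choose_spec]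

lemma expCoeff_of_forall_ne {μ : ℂ} (h : ∀ m : ℕ, (m : ℂ) ≠ μ) : expCoeff μ = 0 :=
  dif_neg fun ⟨m, hm⟩ => h m hm

lemma expCoeff_X_mul (μ : ℂ) (f : ℂ⟦X⟧) :
    expCoeff (μ + 1) (PowerSeries.X * f) = expCoeff μ f := by
  by_cases h : ∃ m : ℕ, (m : ℂ) = μ
  · obtain ⟨m, rfl⟩ := h
    rw [← Nat.cast_succ, expCoeff_natCast, expCoeff_natCast, PowerSeries.coeff_succ_X_mul]
  · push Not at h
    rw [expCoeff_of_forall_ne h]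
    by_cases h' : ∃ m : ℕ, (m : ℂ) = μ + 1
    · obtain ⟨m, hm⟩ := h'
      cases m with
      -- Here `μ = -1`: the identity survives because `b f` has no constant term.
      | zero => rw [← hm, expCoeff_natCast]; simp
      | succ m => exact absurd (by simpa using hm) (h m)
    · push Not at h'
      rw [expCoeff_of_forall_ne h']
      simp

lemma coeff_X_mul_derivative (m : ℕ) (f : ℂ⟦X⟧) :
    PowerSeries.coeff m (PowerSeries.X * PowerSeries.derivative ℂ f) =
      m * PowerSeries.coeff m f := by
  cases m with
  | zero => simp
  | succ m =>
    rw [PowerSeries.coeff_succ_X_mul, PowerSeries.coeff_derivative, mul_comm]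
    simp

lemma expCoeff_X_mul_derivative (μ : ℂ) (f : ℂ⟦X⟧) :
    expCoeff μ (PowerSeries.X * PowerSeries.derivative ℂ f) = μ * expCoeff μ f := by
  by_cases h : ∃ m : ℕ, (m : ℂ) = μ
  · obtain ⟨m, rfl⟩ := h
    rw [expCoeff_natCast, coeff_X_mul_derivative]
  · push Not at h
    simp [expCoeff_of_forall_ne h]

/-- By Artin-Rees, an element of `S` that is divisible by a high power of `b` in `ℂ⟦b⟧ ^ n` is
divisible by `b` in `S`. -/
lemma exists_mem_X_smul {S : Type*} [AddCommGroup S] [Module ℂ⟦X⟧ S] {n : ℕ}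
    (J : S →ₗ[ℂ⟦X⟧] (Fin n → ℂ⟦X⟧)) (hJ : Function.Injective J) : ∃ N : ℕ, ∀ s,
      (∀ i, ∀ m < N, PowerSeries.coeff m (J s i) = 0) → ∃ t, s = (PowerSeries.X : ℂ⟦X⟧) • t := by
  obtain ⟨k, hk⟩ := Ideal.exists_pow_inf_eq_pow_smul (Ideal.span {(PowerSeries.X : ℂ⟦X⟧)})
    (LinearMap.range J)
  -- One step beyond the Artin-Rees constant `k`, the intersection with the range is `b` times a
  -- submodule of the range.
  refine ⟨k + 1, fun s hs => ?_⟩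
  have h1 : J s ∈ Ideal.span {(PowerSeries.X : ℂ⟦X⟧)} ^ (k + 1) •
      (⊤ : Submodule ℂ⟦X⟧ (Fin n → ℂ⟦X⟧)) ⊓ LinearMap.range J := by
    refine ⟨?_, s, rfl⟩
    choose g hg using fun i => PowerSeries.X_pow_dvd_iff.2 (hs i)
    have e : J s = (PowerSeries.X ^ (k + 1) : ℂ⟦X⟧) • g := funext hg
    rw [e]
    exact Submodule.smul_mem_smul (Ideal.pow_mem_pow (Ideal.mem_span_singleton_self _) _)
      Submodule.mem_top
  rw [hk (k + 1) (by omega), Nat.add_sub_cancel_left, pow_one,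
    Submodule.ideal_span_singleton_smul, Submodule.mem_smul_pointwise_iff_exists] at h1
  obtain ⟨_, ⟨-, t, rfl⟩, h⟩ := h1
  exact ⟨t, hJ (by rw [map_smul, h])⟩

lemma apply_aeval_of_eigen {S : Type*} [AddCommGroup S] [Module ℂ S] (D : S →ₗ[ℂ] S)
    {lam : ℂ} {φ : S →ₗ[ℂ] ℂ} (hφ : ∀ s, φ (D s) = lam * φ s) (P : ℂ[X]) (s : S) :
    φ (Polynomial.aeval D P s) = P.eval lam * φ s := by
  induction P using Polynomial.induction_on generalizing s with
  | C c => simp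
  | add P Q hP hQ =>
    rw [map_add, LinearMap.add_apply, map_add, hP, hQ, Polynomial.eval_add, add_mul]
  | monomial k c hP =>
    rw [pow_succ, ← mul_assoc, map_mul, Module.End.mul_apply, hP, Polynomial.aeval_X, hφ,
      Polynomial.eval_mul_X, mul_assoc]

section Lift

variable {S : Type*} [AddCommGroup S] [Module ℂ⟦X⟧ S] [Module ℂ S] [IsScalarTower ℂ ℂ⟦X⟧ S]
  (D : S →ₗ[ℂ] S) {n : ℕ} {ν : Fin n → ℂ} (J : S →ₗ[ℂ⟦X⟧] (Fin n → ℂ⟦X⟧))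

/-- The monomial `b ^ m` in coordinate `i` is an eigenvector of weight `ν i + m`, so a polynomial in
`D` acts on it by its value there. -/
lemma coeff_aeval_apply
    (hD : ∀ s i, J (D s) i = ν i • J s i + PowerSeries.X * PowerSeries.derivative ℂ (J s i))
    (P : ℂ[X]) (s : S) (i : Fin n) (m : ℕ) :
    PowerSeries.coeff m (J (Polynomial.aeval D P s) i) =
      P.eval (ν i + m) * PowerSeries.coeff m (J s i) := by
  have hJ : ∀ (c : ℂ) s, J (c • s) = c • J s := fun c s => by
    rw [← C_smul c s, map_smul, C_smul]
  induction P using Polynomial.induction_on generalizing s with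
  | C c => simp [hJ]
  | add P Q hP hQ =>
    rw [map_add, LinearMap.add_apply, map_add, Pi.add_apply, map_add, hP, hQ, Polynomial.eval_add,
      add_mul]
  | monomial k c hP =>
    rw [pow_succ, ← mul_assoc, map_mul, Module.End.mul_apply, hP, Polynomial.aeval_X, hD, map_add,
      coeff_X_mul_derivative, Polynomial.eval_mul_X, map_smul, smul_eq_mul]
    ring

/-- The homogeneous component of weight `μ` of an element of `⨁ E_(ν i)`. -/
def component (ν : Fin n → ℂ) (μ : ℂ) : (Fin n → ℂ⟦X⟧) →ₗ[ℂ] (Fin n → ℂ) :=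
  LinearMap.pi fun i => expCoeff (μ - ν i) ∘ₗ LinearMap.proj i

lemma component_apply (ν : Fin n → ℂ) (μ : ℂ) (g : Fin n → ℂ⟦X⟧) (i : Fin n) :
    component ν μ g i = expCoeff (μ - ν i) (g i) := rfl

/-- An eigenfunctional of weight `λ` on `S / b S` only depends on the component of weight `λ`. -/
lemma eq_zero_of_component_eq_zero (hJ : Function.Injective J)
    (hD : ∀ s i, J (D s) i = ν i • J s i + PowerSeries.X * PowerSeries.derivative ℂ (J s i))
    {lam : ℂ} {φ : S →ₗ[ℂ] ℂ} (hX : ∀ s, φ ((PowerSeries.X : ℂ⟦X⟧) • s) = 0)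
    (hφ : ∀ s, φ (D s) = lam * φ s) {s : S} (hs : component ν lam (J s) = 0) : φ s = 0 := by
  classical
  obtain ⟨N, hN⟩ := exists_mem_X_smul J hJ
  -- `R` holds the weights other than `λ` of the monomials of order `< N`. Thus `Q(D) s` has no
  -- coefficient of order `< N`: those of weight `λ` vanish by `hs`, the others by `Q`. So `Q(D) s`
  -- lies in `b S`, whereas `Q(λ) ≠ 0`.
  let R : Finset ℂ :=
    ((Finset.univ ×ˢ Finset.range N).image fun p : Fin n × ℕ => ν p.1 + p.2).erase lam
  let Q : ℂ[X] := ∏ r ∈ R, (Polynomial.X - Polynomial.C r)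
  have hQ : Q.eval lam ≠ 0 := by
    rw [Polynomial.eval_prod, Finset.prod_ne_zero_iff]
    intro r hr
    simpa [sub_eq_zero] using (Finset.ne_of_mem_erase hr).symm
  obtain ⟨t, ht⟩ := hN (Polynomial.aeval D Q s) fun i m hm => by
    rw [coeff_aeval_apply D J hD]
    by_cases h : ν i + m = lam
    · have h0 := congrFun hs i
      rw [component_apply, ← h, add_sub_cancel_left, expCoeff_natCast] at h0
      rw [h0, Pi.zero_apply, mul_zero]
    · have hm' : ν i + m ∈ R := Finset.mem_erase.2 ⟨h, Finset.mem_image.2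
        ⟨(i, m), by simpa using hm, rfl⟩⟩
      rw [Polynomial.eval_prod, Finset.prod_eq_zero hm' (by simp), zero_mul]
  have h := apply_aeval_of_eigen D hφ Q s
  rw [ht, hX] at h
  exact (mul_eq_zero.1 h.symm).resolve_left hQ

/-- An eigenfunctional of weight `λ` on `S / b S` lifts to a morphism from `S` to `E_λ`. -/
lemma exists_lift (hJ : Function.Injective J)
    (hD : ∀ s i, J (D s) i = ν i • J s i + PowerSeries.X * PowerSeries.derivative ℂ (J s i))
    {lam : ℂ} {φ : S →ₗ[ℂ] ℂ} (hX : ∀ s, φ ((PowerSeries.X : ℂ⟦X⟧) • s) = 0)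
    (hφ : ∀ s, φ (D s) = lam * φ s) : ∃ Φ : S →ₗ[ℂ⟦X⟧] ℂ⟦X⟧,
      (∀ s, Φ (D s) = lam • Φ s + PowerSeries.X * PowerSeries.derivative ℂ (Φ s)) ∧
      ∀ s, PowerSeries.coeff 0 (Φ s) = φ s := by
  have hJc : ∀ (c : ℂ) s, J (c • s) = c • J s := fun c s => by
    rw [← C_smul c s, map_smul, C_smul]
  let Jc : S →ₗ[ℂ] (Fin n → ℂ⟦X⟧) := { J with map_smul' := hJc }
  -- Vanishing on the kernel of the component map, `φ` factors through it as a linear form `ψ` on `ℂ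
  -- ^ n`.
  have hmem : φ ∈ (LinearMap.ker (component ν lam ∘ₗ Jc)).dualAnnihilator :=
    (Submodule.mem_dualAnnihilator _).2 fun s hs =>
      eq_zero_of_component_eq_zero D J hJ hD hX hφ hs
  rw [← LinearMap.range_dualMap_eq_dualAnnihilator_ker] at hmem
  obtain ⟨ψ, hψ⟩ := hmem
  have hψ' : ∀ s, ψ (component ν lam (J s)) = φ s := fun s => LinearMap.congr_fun hψ s
  -- Multiplication by `b` carries the component of weight `μ` to that of weight `μ + 1`, so
  -- compatibility with `b` forces the same `ψ` at every weight `λ + k`.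
  let Φ : S →ₗ[ℂ] ℂ⟦X⟧ :=
    { toFun := fun s => PowerSeries.mk fun k => ψ (component ν (lam + k) (J s))
      map_add' := fun s t => by ext1 k; simp
      map_smul' := fun c s => by ext1 k; simp [hJc] }
  have hΦ : ∀ s k, PowerSeries.coeff k (Φ s) = ψ (component ν (lam + k) (J s)) :=
    fun s k => PowerSeries.coeff_mk k
      fun k : ℕ => ψ (component ν (lam + k) (J s))
  have hΦ0 : ∀ s, PowerSeries.coeff 0 (Φ s) = φ s := fun s => by
    rw [hΦ, Nat.cast_zero, add_zero, hψ']
  have hΦX : ∀ s, Φ ((PowerSeries.X : ℂ⟦X⟧) • s) = (PowerSeries.X : ℂ⟦X⟧) • Φ s := by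
    intro s
    ext1 k
    cases k with
    -- The constant term is not covered by the shift of weights; it is where `φ` must vanish on `b
    -- S`.
    | zero => rw [hΦ0, hX]; simp
    | succ k =>
      rw [smul_eq_mul, PowerSeries.coeff_succ_X_mul, hΦ, hΦ, map_smul]
      congr 1
      ext i
      rw [component_apply, component_apply, Pi.smul_apply, smul_eq_mul,
        ← expCoeff_X_mul (lam + k - ν i)]
      congr 2
      push_cast
      ring
  refine ⟨{ Φ with map_smul' := map_series_smul isXSeparated_series Φ hΦX }, fun s => ?_, hΦ0⟩
  change Φ (D s) = lam • Φ s + PowerSeries.X * PowerSeries.derivative ℂ (Φ s)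
  ext1 k
  rw [map_add, coeff_X_mul_derivative, map_smul, smul_eq_mul, ← add_mul, hΦ, hΦ, ← smul_eq_mul,
    ← map_smul]
  congr 1
  ext i
  rw [Pi.smul_apply, component_apply, component_apply, hD, map_add, map_smul,
    expCoeff_X_mul_derivative, smul_eq_mul, smul_eq_mul]
  ring

end Lift

/-! ### The two implications. -/

section Main

variable {F : Type*} [AddCommGroup F] [Module ℂ⟦X⟧ F] [Module ATilde F]
  [IsScalarTower ℂ⟦X⟧ ATilde F] [Module ℂ F] [IsScalarTower ℂ ℂ⟦X⟧ F] [Module.Free ℂ⟦X⟧ F]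
  {k : ℕ} {L : sharp F →ₗ[ℂ⟦X⟧] F}

/-- The factor `b ^ k` in `L` lowers the weight from `λ` to `λ - k`. -/
lemma lattice_map_nablaSharp
    (hL : ∀ z : sharp F,
      LocalizedModule.mk (L z) 1 = (PowerSeries.X ^ k : ℂ⟦X⟧) • (z : Loc F))
    {lam : ℂ} {Ψ : F →ₗ[ℂ⟦X⟧] ℂ⟦X⟧} (hΨ : ∀ x, Ψ (a • x) =
      PowerSeries.X * (lam • Ψ x + PowerSeries.X * PowerSeries.derivative ℂ (Ψ x)))
    (z : sharp F) : Ψ (L (nablaSharp F z)) =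
      (lam - k) • Ψ (L z) + PowerSeries.X * PowerSeries.derivative ℂ (Ψ (L z)) := by
  have h := hΨ (L z)
  rw [a_smul_lattice_map hL, map_smul, smul_eq_mul, map_add, map_smul] at h
  have h' := mul_left_cancel₀ PowerSeries.X_ne_zero h
  have hk : (k : ℂ⟦X⟧) • Ψ (L z) = (k : ℂ) • Ψ (L z) := by
    rw [PowerSeries.smul_eq_C_mul, map_natCast, smul_eq_mul]
  rw [hk] at h'
  rw [sub_smul, sub_add_eq_add_sub, ← h', add_sub_cancel_right]

/-- The extension of `Ψ` to `F^♯` is `b ^ (-k) Ψ L`. It has no pole because `b ^ k ℂ⟦b⟧` contains `Ψ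
L (F)` and is stable under `λ - k + b d/db`. Its constant term, the coefficient of `b ^ k` in `Ψ L`,
is the functional sought. -/
lemma exists_functional_of_surjective
    (hL : ∀ z : sharp F,
      LocalizedModule.mk (L z) 1 = (PowerSeries.X ^ k : ℂ⟦X⟧) • (z : Loc F))
    {lam : ℂ} {Ψ : F →ₗ[ℂ⟦X⟧] ℂ⟦X⟧} (hΨ : ∀ x, Ψ (a • x) =
      PowerSeries.X * (lam • Ψ x + PowerSeries.X * PowerSeries.derivative ℂ (Ψ x)))
    (hs : Function.Surjective Ψ) : ∃ φ : sharp F →ₗ[ℂ] ℂ, φ ≠ 0 ∧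
      (∀ z, φ ((PowerSeries.X : ℂ⟦X⟧) • z) = 0) ∧ ∀ z, φ (nablaSharp F z) = lam * φ z := by
  have hLx : ∀ x, L (toSharp x) = (PowerSeries.X ^ k : ℂ⟦X⟧) • x := fun x =>
    mkLinearMap_injective ((hL (toSharp x)).trans
      (map_smul (LocalizedModule.mkLinearMap (Submonoid.powers (PowerSeries.X : ℂ⟦X⟧)) F) _ x).symm)
  have hN := lattice_map_nablaSharp hL hΨ
  let P : Submodule ℂ⟦X⟧ (sharp F) :=
    Submodule.comap (Ψ ∘ₗ L) (Ideal.span {(PowerSeries.X ^ k : ℂ⟦X⟧)})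
  have hP : ∀ z, z ∈ P ↔ (PowerSeries.X ^ k : ℂ⟦X⟧) ∣ Ψ (L z) := fun z =>
    Ideal.mem_span_singleton
  have hdvd : ∀ z, (PowerSeries.X ^ k : ℂ⟦X⟧) ∣ Ψ (L z) := fun z => by
    refine (hP z).1 (mem_of_nablaSharp_stable P (fun x => ?_) (fun z hz => ?_) z)
    · rw [hP, hLx, map_smul]
      exact Dvd.intro _ rfl
    · rw [hP, PowerSeries.X_pow_dvd_iff] at hz ⊢
      intro m hm
      rw [hN, map_add, coeff_X_mul_derivative, map_smul, hz m hm]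
      simp
  let φ : sharp F →ₗ[ℂ] ℂ := PowerSeries.coeff k ∘ₗ (Ψ ∘ₗ L).restrictScalars ℂ
  have hφ : ∀ z, φ z = PowerSeries.coeff k (Ψ (L z)) := fun _ => rfl
  refine ⟨φ, fun h0 => ?_, fun z => ?_, fun z => ?_⟩
  · obtain ⟨x, hx⟩ := hs 1
    have h1 := LinearMap.congr_fun h0 (toSharp x)
    rw [hφ, hLx, map_smul, hx, smul_eq_mul, mul_one, PowerSeries.coeff_X_pow_self] at h1
    exact one_ne_zero h1
  · obtain ⟨g, hg⟩ := hdvd z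
    rw [hφ, map_smul, map_smul, hg, smul_eq_mul, mul_left_comm, PowerSeries.coeff_X_pow_mul']
    simp
  · rw [hφ, hφ, hN, map_add, coeff_X_mul_derivative, map_smul, smul_eq_mul]
    ring

lemma exists_surjective_of_functional
    (hL : ∀ z : sharp F,
      LocalizedModule.mk (L z) 1 = (PowerSeries.X ^ k : ℂ⟦X⟧) • (z : Loc F))
    (hss : IsSemisimple F) {lam : ℂ} {φ : sharp F →ₗ[ℂ] ℂ} (h0 : φ ≠ 0)
    (hX : ∀ z, φ ((PowerSeries.X : ℂ⟦X⟧) • z) = 0) (hφ : ∀ z, φ (nablaSharp F z) = lam * φ z) :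
    ∃ Ψ : F →ₗ[ℂ⟦X⟧] ℂ⟦X⟧, (∀ x, Ψ (a • x) =
      PowerSeries.X * (lam • Ψ x + PowerSeries.X * PowerSeries.derivative ℂ (Ψ x))) ∧
      Function.Surjective Ψ := by
  obtain ⟨n, mu, j, hj⟩ := hss
  let c : ∀ i, F →ₗ[ℂ⟦X⟧] ℂ⟦X⟧ := fun i => (E.equiv (mu i)).symm.toLinearMap ∘ₗ
    { (LinearMap.proj i ∘ₗ j).toAddMonoidHom with
      map_smul' := map_series_smul_of_ATilde (LinearMap.proj i ∘ₗ j) }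
  have hc : ∀ i x, c i x = (E.equiv (mu i)).symm (j x i) := fun _ _ => rfl
  have hca : ∀ i x, c i (a • x) =
      PowerSeries.X * (mu i • c i x + PowerSeries.X * PowerSeries.derivative ℂ (c i x)) := by
    intro i x
    rw [hc, map_smul, Pi.smul_apply, E.equiv_symm_a_smul, hc]
  let J : sharp F →ₗ[ℂ⟦X⟧] (Fin n → ℂ⟦X⟧) := LinearMap.pi c ∘ₗ L
  have hJ : Function.Injective J := by
    intro z w h
    refine lattice_map_injective hL (hj (funext fun i => (E.equiv (mu i)).symm.injective ?_))
    exact congrFun h i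
  -- The weights are `mu i - k` since the embedding of `F^♯` goes through `L`.
  obtain ⟨Φ, hΦ, hΦ0⟩ := exists_lift (nablaSharp F) (ν := fun i => mu i - k) J hJ
    (fun z i => lattice_map_nablaSharp hL (hca i) z) hX hφ
  refine ⟨Φ ∘ₗ toSharp, fun x => ?_, ?_⟩
  · rw [LinearMap.comp_apply, ← X_smul_nablaSharp_toSharp, map_smul, hΦ, smul_eq_mul]
    rfl
  -- One unit value suffices for surjectivity. Otherwise the constant term of `Φ` vanishes on `F`;
  -- its vanishing is preserved by `b⁻¹ a`, so it would hold on all of `F^♯`, that is, `φ = 0`.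
  · have hu : ∃ x, PowerSeries.coeff 0 (Φ (toSharp x)) ≠ 0 := by
      by_contra! hu
      refine h0 (LinearMap.ext fun z => ?_)
      rw [← hΦ0, LinearMap.zero_apply]
      let P : Submodule ℂ⟦X⟧ (sharp F) :=
        Submodule.comap Φ (RingHom.ker (PowerSeries.constantCoeff (R := ℂ)))
      have hP : ∀ z, z ∈ P ↔ PowerSeries.coeff 0 (Φ z) = 0 := fun z => by
        rw [PowerSeries.coeff_zero_eq_constantCoeff_apply]
        rfl
      refine (hP z).1 (mem_of_nablaSharp_stable P (fun x => (hP _).2 (hu x)) (fun z hz => ?_) z)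
      rw [hP] at hz ⊢
      rw [hΦ, map_add, coeff_X_mul_derivative, map_smul, hz]
      simp
    obtain ⟨x, hx⟩ := hu
    intro f
    refine ⟨(f * (Φ (toSharp x))⁻¹) • x, ?_⟩
    rw [LinearMap.comp_apply, map_smul, map_smul, smul_eq_mul, mul_assoc,
      PowerSeries.inv_mul_cancel _ (by rwa [← PowerSeries.coeff_zero_eq_constantCoeff_apply]),
      mul_one]

end Main

end Barlet
end

theorem mainTheorem6 {F : Type*} [AddCommGroup F] [Module ℂ F] [Module ℂ⟦X⟧ F]
    [Module Barlet.ATilde F] [IsScalarTower ℂ ℂ⟦X⟧ F] [IsScalarTower ℂ⟦X⟧ Barlet.ATilde F]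
    (hF : Barlet.IsFresco F) (hss : Barlet.IsSemisimple F) (lam : ℂ) :
    (Barlet.bernsteinPoly F).IsRoot (-lam) ↔
      ∃ π : F →ₗ[Barlet.ATilde] Barlet.E lam, Function.Surjective π := by
  have := hF.free
  obtain ⟨k, L, hL⟩ := Barlet.exists_lattice_map hF.sharp_fg
  rw [Barlet.isRoot_bernsteinPoly_iff hF.sharp_fg, Barlet.exists_surjective_E_iff]
  constructor
  · rintro ⟨φ, h0, hX, hφ⟩
    exact Barlet.exists_surjective_of_functional hL hss h0 hX hφ
  · rintro ⟨Ψ, hΨ, hs⟩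
    exact Barlet.exists_functional_of_surjective hL hΨ hs
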